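/- Let $L\in\mathbb N=\{1,2,\dots\}$, $\ell_0,\ell_1,\ell_2,\dots\in\mathbb N$, $a\in\mathbb R$, $b\in(a,\infty)$, $\xi\in\mathbb R^{\ell_L}$, and let $\mathfrak d=\sum_{k=1}^L\ell_k(\ell_{k-1}+1)$. Write $\|\cdot\|$ for the Euclidean norm. For $\theta=(\theta_1,\dots,\theta_{\mathfrak d})\in\mathbb R^{\mathfrak d}$ and $k\in\{1,\dots,L\}$ let $\mathcal A_k^\theta\colon\mathbb R^{\ell_{k-1}}\to\mathbb R^{\ell_k}$ be the affine map $\mathcal A_k^\theta(x)=\mathfrak b^{k,\theta}+\mathfrak w^{k,\theta}x$ with $$\mathfrak w^{k,\theta}_{i,j}=\theta_{(i-1)\ell_{k-1}+j+\sum_{h=1}^{k-1}\ell_h(\ell_{h-1}+1)},\qquad \mathfrak b^{k,\theta}_i=\theta_{\ell_k\ell_{k-1}+i+\sum_{h=1}^{k-1}\ell_h(\ell_{h-1}+1)}$$ for $i\in\{1,\dots,\ell_k\}$, $j\in\{1,\dots,\ell_{k-1}\}$. Let $\mathscr R_\infty(y)=\max\{y,0\}$ and let $\mathscr R_r\in C^1(\mathbb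 R,\mathbb R)$, $r\in[1,\infty)$, satisfy $\mathscr R_r(x)=0$ for $x\le\frac1{2r}$, $\mathscr R_r(z)=z$ for $z\ge\frac1r$, $0\le\mathscr R_r(y)\le\mathscr R_\infty(y)$ for all $y\in\mathbb R$, and $\sup_{r\in[1,\infty)}\sup_{x\in\mathbb R}|\mathscr R_r'(x)|<\infty$. For $r\in[1,\infty]$ and $\theta\in\mathbb R^{\mathfrak d}$ define $\mathcal N_r^{k,\theta}\colon\mathbb R^{\ell_0}\to\mathbb R^{\ell_k}$, $k\in\{1,\dots,L\}$, by $\mathcal N_r^{1,\theta}=\mathcal A_1^\theta$ and $\mathcal N_r^{k+1,\theta}(x)=\mathcal A_{k+1}^\theta\big(\mathscr R_{r^{1/k}}(\mathcal N_r^{k,\theta}(x))\big)$ for $k<L$, where $\mathscr R_{r^{1/k}}$ is applied componentwise and $\infty^{1/k}=\infty$. Let $(\Omega,\mathcal F,\mathbb P)$ be a probability space, let $X^{n,m}\colon\Omega\to[a,b]^{\ell_0}$, $n,m\in\mathbb N_0=\mathbb N\cup\{0\}$, be i.i.d. random variables, let $M_n\in\mathbb N$, $n\in\mathbb N_0$,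 and for $r\in[1,\infty)$, $n\in\mathbb N_0$, $\theta\in\mathbb R^{\mathfrak d}$, $\omega\in\Omega$ let $$\mathfrak L_r^n(\theta,\omega)=\frac1{M_n}\sum_{m=1}^{M_n}\big\|\mathcal N_r^{L,\theta}(X^{n,m}(\omega))-\xi\big\|^2,\qquad \mathcal L(\theta)=\mathbb E\big[\|\mathcal N_\infty^{L,\theta}(X^{0,0})-\xi\|^2\big].$$ For every $n\in\mathbb N_0$ let $\mathfrak G^n\colon\mathbb R^{\mathfrak d}\times\Omega\to\mathbb R^{\mathfrak d}$ satisfy $\mathfrak G^n(\theta,\omega)=\lim_{r\to\infty}(\nabla_\theta\mathfrak L_r^n)(\theta,\omega)$ for all $(\theta,\omega)$ for which this limit exists. Let $\Theta=(\Theta_n)_{n\in\mathbb N_0}\colon\mathbb N_0\times\Omega\to\mathbb R^{\mathfrak d}$ be a stochastic process such that $\Theta_0$ and $(X^{n,m})_{(n,m)\in\mathbb N_0^2}$ are independent, let $\gamma_n\in[0,\infty)$, $n\in\mathbb N_0$, satisfy $\sum_{n=0}^\infty\gamma_n=\infty$, and assume for all $n\in\mathbb N_0$ that $$\Theta_{n+1}(\omega)=\Theta_n(\omega)-\gamma_n\,\mathfrak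 G^n(\Theta_n(\omega),\omega)\quad\text{for all }\omega\in\Omega,$$ and, $\mathbb P$-almost surely, $$\big(4L\mathfrak d\max\{|a|,|b|,\|\xi\|,1\}\big)^{2L}\gamma_n\le(\|\Theta_0\|+1)^{-2L}.$$ Then (i) there exists $\mathfrak C\in\mathbb R$ such that $\mathbb P\big(\sup_{n\in\mathbb N_0}\|\Theta_n\|\le\mathfrak C\big)=1$; (ii) $\mathbb P\big(\lim_{n\to\infty}\mathcal L(\Theta_n)=0\big)=1$; (iii) $\mathbb E[\mathcal L(\Theta_n)]<\infty$ for all $n\in\mathbb N_0$, and $\lim_{n\to\infty}\mathbb E[\mathcal L(\Theta_n)]=0$. -/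

import Mathlib

open Filter Topology MeasureTheory ProbabilityTheory

namespace DeepReLU

/-- The number of real parameters of a fully-connected feedforward network with `L` affine layers
and layer dimensions `ℓ 0, ℓ 1, …, ℓ L`, that is, `∑_{k=1}^{L} ℓ_k (ℓ_{k-1} + 1)`. -/
def numParams (ℓ : ℕ → ℕ) (L : ℕ) : ℕ :=
  ∑ k ∈ Finset.range L, ℓ (k + 1) * (ℓ k + 1)

/-- The parameter space `ℝ^𝔡` with the Euclidean norm. -/
abbrev Params (ℓ : ℕ → ℕ) (L : ℕ) : Type :=
  EuclideanSpace ℝ (Fin (numParams ℓ L))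

/-- The coordinate of the parameter vector `θ` with number `n` (counted from `0`). The value `0` for
`n` out of range is never used in the first `L` layers, see `weightIndex_lt` and `biasIndex_lt`. -/
noncomputable def coord {ℓ : ℕ → ℕ} {L : ℕ} (θ : Params ℓ L) (n : ℕ) : ℝ :=
  if h : n < numParams ℓ L then θ ⟨n, h⟩ else 0

/-- The position in the parameter vector of the weight with row `i` and column `j` in the affine
map from `ℝ^(ℓ k)` to `ℝ^(ℓ (k + 1))`. Everything is counted from `0`. -/
def weightIndex (ℓ : ℕ → ℕ) (k i j : ℕ) : ℕ :=
  i * ℓ k + j + numParams ℓ k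

/-- The position in the parameter vector of the `i`-th bias in the affine map from `ℝ^(ℓ k)` to
`ℝ^(ℓ (k + 1))`. Everything is counted from `0`. -/
def biasIndex (ℓ : ℕ → ℕ) (k i : ℕ) : ℕ :=
  ℓ (k + 1) * ℓ k + i + numParams ℓ k

theorem numParams_succ_le (ℓ : ℕ → ℕ) {L k : ℕ} (hk : k < L) :
    numParams ℓ k + ℓ (k + 1) * (ℓ k + 1) ≤ numParams ℓ L := by
  have h : numParams ℓ (k + 1) ≤ numParams ℓ L :=
    Finset.sum_le_sum_of_subset (Finset.range_mono hk)
  rwa [numParams, Finset.sum_range_succ] at h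

theorem weightIndex_lt (ℓ : ℕ → ℕ) {L k i j : ℕ} (hk : k < L) (hi : i < ℓ (k + 1))
    (hj : j < ℓ k) : weightIndex ℓ k i j < numParams ℓ L := by
  have h := numParams_succ_le ℓ hk
  have h2 : (i + 1) * ℓ k ≤ ℓ (k + 1) * ℓ k := Nat.mul_le_mul_right _ hi
  rw [weightIndex]
  nlinarith

theorem biasIndex_lt (ℓ : ℕ → ℕ) {L k i : ℕ} (hk : k < L) (hi : i < ℓ (k + 1)) :
    biasIndex ℓ k i < numParams ℓ L := by
  have h := numParams_succ_le ℓ hk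
  rw [biasIndex]
  nlinarith

/-- The weight matrix of the affine map from `ℝ^(ℓ k)` to `ℝ^(ℓ (k + 1))`. -/
noncomputable def weight {ℓ : ℕ → ℕ} {L : ℕ} (θ : Params ℓ L) (k : ℕ) :
    Matrix (Fin (ℓ (k + 1))) (Fin (ℓ k)) ℝ :=
  Matrix.of fun i j => coord θ (weightIndex ℓ k i j)

/-- The bias vector of the affine map from `ℝ^(ℓ k)` to `ℝ^(ℓ (k + 1))`. -/
noncomputable def bias {ℓ : ℕ → ℕ} {L : ℕ} (θ : Params ℓ L) (k : ℕ) :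
    Fin (ℓ (k + 1)) → ℝ :=
  fun i => coord θ (biasIndex ℓ k i)

/-- The affine map `x ↦ b + W x` from `ℝ^(ℓ k)` to `ℝ^(ℓ (k + 1))` (the affine layer with number
`k + 1` when layers are counted from `1`). -/
noncomputable def affine {ℓ : ℕ → ℕ} {L : ℕ} (θ : Params ℓ L) (k : ℕ)
    (x : EuclideanSpace ℝ (Fin (ℓ k))) : EuclideanSpace ℝ (Fin (ℓ (k + 1))) :=
  WithLp.toLp 2 (bias θ k + (weight θ k).mulVec x.ofLp)

/-- The componentwise application of an activation function `σ : ℝ → ℝ`. -/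
def componentwise (σ : ℝ → ℝ) {n : ℕ} (x : EuclideanSpace ℝ (Fin n)) :
    EuclideanSpace ℝ (Fin n) :=
  WithLp.toLp 2 fun i => σ (x i)

/-- The output after `k` affine layers of the network with parameters `θ` in which the activation
function on the `k`-th hidden layer is `σ k` (`k = 1, 2, …`):
`N¹(x) = A₁ x` and `N^{k+1}(x) = A_{k+1} (σ_k (N^k x))`; by convention `N⁰(x) = x`. -/
noncomputable def network {ℓ : ℕ → ℕ} {L : ℕ} (σ : ℕ → ℝ → ℝ) (θ : Params ℓ L)
    (x : EuclideanSpace ℝ (Fin (ℓ 0))) : (k : ℕ) → EuclideanSpace ℝ (Fin (ℓ k))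
  | 0 => x
  | 1 => affine θ 0 x
  | k + 2 => affine θ (k + 1) (componentwise (σ (k + 1)) (network σ θ x (k + 1)))

/-- The ReLU activation function, used on every hidden layer (the case `r = ∞`). -/
def reluActivation : ℕ → ℝ → ℝ := fun _ y => max y 0

/-- For `r ∈ [1, ∞)` the activation function on the `k`-th hidden layer is the approximation of
ReLU with index `r^{1/k}`. -/
noncomputable def approxActivation (R : ℝ → ℝ → ℝ) (r : ℝ) : ℕ → ℝ → ℝ :=
  fun k => R (r ^ (1 / (k : ℝ)))

/-- `(R_r)_{r ∈ [1, ∞)}` is a family of `C¹` approximations of ReLU as used for the definition of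
generalized gradients. -/
structure IsReLUApproximation (R : ℝ → ℝ → ℝ) : Prop where
  contDiff : ∀ r : ℝ, 1 ≤ r → ContDiff ℝ 1 (R r)
  eq_zero : ∀ r : ℝ, 1 ≤ r → ∀ x : ℝ, x ≤ 2⁻¹ * r⁻¹ → R r x = 0
  nonneg : ∀ r : ℝ, 1 ≤ r → ∀ y : ℝ, 0 ≤ R r y
  le_relu : ∀ r : ℝ, 1 ≤ r → ∀ y : ℝ, R r y ≤ max y 0
  eq_self : ∀ r : ℝ, 1 ≤ r → ∀ z : ℝ, r⁻¹ ≤ z → R r z = z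
  deriv_bounded : ∃ C : ℝ, ∀ r : ℝ, 1 ≤ r → ∀ x : ℝ, |deriv (R r) x| ≤ C

/-- The empirical risk `(1/M) ∑_{m=1}^{M} ‖N^{L,θ}(x_m) - ξ‖²` on the data `x_1, …, x_M`. -/
noncomputable def empiricalRisk {ℓ : ℕ → ℕ} {L : ℕ} (σ : ℕ → ℝ → ℝ)
    (ξ : EuclideanSpace ℝ (Fin (ℓ L))) (M : ℕ) (x : ℕ → EuclideanSpace ℝ (Fin (ℓ 0)))
    (θ : Params ℓ L) : ℝ :=
  1 / (M : ℝ) * ∑ m ∈ Finset.Icc 1 M, ‖network σ θ (x m) L - ξ‖ ^ 2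

/-- The risk `E[‖N_∞^{L,θ}(X) - ξ‖²]` of the ReLU network with random input `X`. -/
noncomputable def risk {ℓ : ℕ → ℕ} {L : ℕ} {Ω : Type*} [MeasurableSpace Ω] (P : Measure Ω)
    (X : Ω → EuclideanSpace ℝ (Fin (ℓ 0))) (ξ : EuclideanSpace ℝ (Fin (ℓ L)))
    (θ : Params ℓ L) : ℝ :=
  ∫ ω, ‖network reluActivation θ (X ω) L - ξ‖ ^ 2 ∂P

/-- `G n θ ω` is the limit as `r → ∞` of the gradients `(∇_θ 𝔏_r^n)(θ, ω)` of the approximated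
empirical risks of the `n`-th mini-batch, wherever this limit exists. -/
def IsGeneralizedGradient {ℓ : ℕ → ℕ} {L : ℕ} {Ω : Type*} (R : ℝ → ℝ → ℝ)
    (ξ : EuclideanSpace ℝ (Fin (ℓ L))) (M : ℕ → ℕ)
    (X : ℕ → ℕ → Ω → EuclideanSpace ℝ (Fin (ℓ 0)))
    (G : ℕ → Params ℓ L → Ω → Params ℓ L) : Prop :=
  ∀ (n : ℕ) (θ : Params ℓ L) (ω : Ω),
    (∃ g : Params ℓ L, Tendsto (fun r : ℝ =>
      gradient (empiricalRisk (approxActivation R r) ξ (M n) fun m => X n m ω) θ)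
      atTop (𝓝 g)) →
    Tendsto (fun r : ℝ =>
      gradient (empiricalRisk (approxActivation R r) ξ (M n) fun m => X n m ω) θ)
      atTop (𝓝 (G n θ ω))

end DeepReLU

namespace DeepReLU

variable {ℓ : ℕ → ℕ} {L : ℕ}

/-! ### Coordinates of parameter vectors -/

/-! The proof is a Lyapunov argument for `lyapunov`, a weighted squared distance to the parameter
that outputs `ξ` constantly (all parameters zero except the last bias). The weights come from a
scaling symmetry. With the activation pattern frozen, the output is polynomial in the parameters.
Multiplying all weights by `e^t` and the biases of affine layer `k` (counted from 0) by `e^{(k+1)t}`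
multiplies the output by `e^{(K+1)t}`, where `L = K + 1`. Differentiating at `t = 0`, and shifting
the last bias by `ξ`, gives `outputDeriv_lyapunovDir`: along half the gradient of `lyapunov` the
output moves by `(K+1)(N - ξ)`. So the generalized gradient paired with this direction is exactly
`2(K+1)` times the empirical risk. The squared norm of the gradient is also at most a constant times
the empirical risk (`norm_sq_riskGradient_le`). For small steps the quadratic error is therefore
absorbed, and each step lowers `lyapunov` by at least `3(K+1)γ` times the empirical risk
(`lyapunov_step_le`). Hence trajectories stay bounded and `∑ γ_n · (empirical risk)` is bounded.
Since some `γ_n` is positive, the step size condition bounds `Θ_0`, so both bounds are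
deterministic. The iterate `Θ_n` is independent of the `n`-th batch, so in expectation the empirical
risk may be replaced by the risk, and `∑ γ_n · risk(Θ_n)` is almost surely finite. The risk is
locally Lipschitz and `Θ` moves by `O(γ_n)`; with `∑ γ_n = ∞` this forces convergence to zero
(`tendsto_zero_of_summable_mul`). Dominated convergence gives the expectations. -/

theorem coord_add (θ η : Params ℓ L) (n : ℕ) : coord (θ + η) n = coord θ n + coord η n := by
  unfold coord; split_ifs <;> simp

theorem coord_sub (θ η : Params ℓ L) (n : ℕ) : coord (θ - η) n = coord θ n - coord η n := by
  unfold coord; split_ifs <;> simp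

theorem coord_smul (c : ℝ) (θ : Params ℓ L) (n : ℕ) : coord (c • θ) n = c * coord θ n := by
  unfold coord; split_ifs <;> simp

theorem contDiff_coord (n : ℕ) : ContDiff ℝ 1 fun θ : Params ℓ L => coord θ n := by
  unfold coord; split_ifs <;> fun_prop

/-- Out-of-range positions contribute zero, so injectivity of `f` is enough. -/
theorem sum_sq_coord_le {ι : Type*} [Fintype ι] (θ : Params ℓ L) (f : ι → ℕ)
    (hf : Function.Injective f) : ∑ i, coord θ (f i) ^ 2 ≤ ‖θ‖ ^ 2 := by
  classical
  have h0 : ‖θ‖ ^ 2 = ∑ n ∈ Finset.range (numParams ℓ L), coord θ n ^ 2 := by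
    rw [EuclideanSpace.norm_sq_eq, Finset.sum_range]
    exact Finset.sum_congr rfl fun i _ => by simp [coord]
  have h1 : ∑ i, coord θ (f i) ^ 2 = ∑ n ∈ Finset.univ.image f, coord θ n ^ 2 := by
    rw [Finset.sum_image fun a _ b _ h => hf h]
  rw [h0, h1, ← Finset.sum_filter_add_sum_filter_not _ (fun n => n < numParams ℓ L)]
  have h2 : ∑ n ∈ Finset.univ.image f with ¬ n < numParams ℓ L, coord θ n ^ 2 = 0 :=
    Finset.sum_eq_zero fun n hn => by simp [coord, (Finset.mem_filter.1 hn).2]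
  rw [h2, add_zero]
  refine Finset.sum_le_sum_of_subset_of_nonneg (fun n hn => ?_) fun _ _ _ => sq_nonneg _
  simpa using (Finset.mem_filter.1 hn).2

/-- The position of the bias (`none`) or of a weight (`some j`) in row `i` of layer `k`. -/
def rowIndex (ℓ : ℕ → ℕ) (k : ℕ) (p : Fin (ℓ (k + 1)) × Option (Fin (ℓ k))) : ℕ :=
  p.2.elim (biasIndex ℓ k p.1) fun j => weightIndex ℓ k p.1 j

theorem weight_offset_lt {m n : ℕ} (i : Fin m) (j : Fin n) : (i : ℕ) * n + j < m * n := by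
  have h2 : ((i : ℕ) + 1) * n ≤ m * n := Nat.mul_le_mul_right _ i.2
  have := j.2
  nlinarith

/-- Within a layer the biases come after all weights, and division by `ℓ k` with remainder recovers
row and column. -/
theorem rowIndex_injective (ℓ : ℕ → ℕ) (k : ℕ) : Function.Injective (rowIndex ℓ k) := by
  rintro ⟨i, _ | j⟩ ⟨i', _ | j'⟩ h
  · simp only [rowIndex, Option.elim_none, biasIndex] at h
    have : i = i' := Fin.ext (by omega)
    rw [this]
  · simp only [rowIndex, Option.elim_none, Option.elim_some, biasIndex, weightIndex] at h
    have := weight_offset_lt i' j'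
    omega
  · simp only [rowIndex, Option.elim_none, Option.elim_some, biasIndex, weightIndex] at h
    have := weight_offset_lt i j
    omega
  · simp only [rowIndex, Option.elim_some, weightIndex] at h
    have h' : (j : ℕ) + ℓ k * i = j' + ℓ k * i' := by
      rw [mul_comm (ℓ k), mul_comm (ℓ k)]; omega
    have hj : (j : ℕ) = j' := by
      have := congrArg (· % ℓ k) h'
      simpa [Nat.mod_eq_of_lt j.2, Nat.mod_eq_of_lt j'.2] using this
    have hi : (i : ℕ) = i' := by
      have := congrArg (· / ℓ k) h'
      have hp : 0 < ℓ k := lt_of_le_of_lt (Nat.zero_le _) j.2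
      simpa [Nat.add_mul_div_left _ _ hp, Nat.div_eq_of_lt j.2, Nat.div_eq_of_lt j'.2] using this
    rw [Fin.ext hi, Fin.ext hj]

theorem sum_sq_layer_le (θ : Params ℓ L) (k : ℕ) :
    ∑ i : Fin (ℓ (k + 1)), (coord θ (biasIndex ℓ k i) ^ 2
      + ∑ j : Fin (ℓ k), coord θ (weightIndex ℓ k i j) ^ 2) ≤ ‖θ‖ ^ 2 := by
  have h := sum_sq_coord_le θ (rowIndex ℓ k) (rowIndex_injective ℓ k)
  rw [Fintype.sum_prod_type] at h
  simpa [Fintype.sum_option, rowIndex] using h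

/-! ### Affine layers -/

/-- The linear part `v ↦ W v` of an affine layer. -/
noncomputable def linearPart (θ : Params ℓ L) (k : ℕ) (v : EuclideanSpace ℝ (Fin (ℓ k))) :
    EuclideanSpace ℝ (Fin (ℓ (k + 1))) :=
  WithLp.toLp 2 ((weight θ k).mulVec v.ofLp)

theorem affine_apply (θ : Params ℓ L) (k : ℕ) (v : EuclideanSpace ℝ (Fin (ℓ k)))
    (i : Fin (ℓ (k + 1))) :
    affine θ k v i =
      coord θ (biasIndex ℓ k i) + ∑ j : Fin (ℓ k), coord θ (weightIndex ℓ k i j) * v j := rfl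

theorem linearPart_apply (θ : Params ℓ L) (k : ℕ) (v : EuclideanSpace ℝ (Fin (ℓ k)))
    (i : Fin (ℓ (k + 1))) :
    linearPart θ k v i = ∑ j : Fin (ℓ k), coord θ (weightIndex ℓ k i j) * v j := rfl

/-- An exact product rule. The right side has the shape of a layer derivative in direction `θ - η`,
so one estimate serves both the derivative and the Lipschitz bound. -/
theorem affine_sub_affine (θ η : Params ℓ L) (k : ℕ) (u v : EuclideanSpace ℝ (Fin (ℓ k))) :
    affine θ k u - affine η k v = affine (θ - η) k v + linearPart θ k (u - v) := by
  ext i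
  simp only [PiLp.sub_apply, PiLp.add_apply, affine_apply, linearPart_apply, coord_sub, sub_mul,
    mul_sub, Finset.sum_sub_distrib]
  ring

/-- Cauchy–Schwarz in each row against the vector `(1, v)`, the bias being the coefficient of `1`.
-/
theorem norm_sq_affine_le (θ : Params ℓ L) (k : ℕ) (v : EuclideanSpace ℝ (Fin (ℓ k))) :
    ‖affine θ k v‖ ^ 2 ≤ ‖θ‖ ^ 2 * (‖v‖ ^ 2 + 1) := by
  refine le_trans ?_ (mul_le_mul_of_nonneg_right (sum_sq_layer_le θ k) (by positivity))
  rw [EuclideanSpace.norm_sq_eq, EuclideanSpace.norm_sq_eq, Finset.sum_mul]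
  refine Finset.sum_le_sum fun i _ => ?_
  have h := Finset.sum_mul_sq_le_sq_mul_sq Finset.univ
    (fun o : Option (Fin (ℓ k)) => coord θ (rowIndex ℓ k (i, o)))
    (fun o => o.elim 1 fun j => v j)
  simp only [Fintype.sum_option, rowIndex, Option.elim_none, Option.elim_some, mul_one,
    one_pow] at h
  simpa [affine_apply, sq_abs, add_comm (1 : ℝ)] using h

theorem norm_linearPart_le (θ : Params ℓ L) (k : ℕ) (v : EuclideanSpace ℝ (Fin (ℓ k))) :
    ‖linearPart θ k v‖ ≤ ‖θ‖ * ‖v‖ := by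
  refine (sq_le_sq₀ (by positivity) (by positivity)).1 ?_
  rw [mul_pow]
  refine le_trans ?_ (mul_le_mul_of_nonneg_right (sum_sq_layer_le θ k) (by positivity))
  rw [EuclideanSpace.norm_sq_eq, EuclideanSpace.norm_sq_eq, Finset.sum_mul]
  refine Finset.sum_le_sum fun i _ => ?_
  have h := Finset.sum_mul_sq_le_sq_mul_sq Finset.univ
    (fun j : Fin (ℓ k) => coord θ (weightIndex ℓ k i j)) (fun j => v j)
  simp only [linearPart_apply, Real.norm_eq_abs, sq_abs]
  refine h.trans (mul_le_mul_of_nonneg_right ?_ (by positivity))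
  exact le_add_of_nonneg_left (sq_nonneg _)

theorem norm_affine_le (θ : Params ℓ L) (k : ℕ) (v : EuclideanSpace ℝ (Fin (ℓ k))) :
    ‖affine θ k v‖ ≤ ‖θ‖ * √(‖v‖ ^ 2 + 1) := by
  refine (sq_le_sq₀ (by positivity) (by positivity)).1 ?_
  rw [mul_pow, Real.sq_sqrt (by positivity)]
  exact norm_sq_affine_le θ k v

/-! ### Hidden layers -/

/-- The input of the affine layer with number `k` (counted from `0`). -/
noncomputable def hidden (σ : ℕ → ℝ → ℝ) (θ : Params ℓ L) (x : EuclideanSpace ℝ (Fin (ℓ 0))) :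
    (k : ℕ) → EuclideanSpace ℝ (Fin (ℓ k))
  | 0 => x
  | k + 1 => componentwise (σ (k + 1)) (affine θ k (hidden σ θ x k))

theorem network_succ (σ : ℕ → ℝ → ℝ) (θ : Params ℓ L) (x : EuclideanSpace ℝ (Fin (ℓ 0))) (k : ℕ) :
    network σ θ x (k + 1) = affine θ k (hidden σ θ x k) := by
  induction k with
  | zero => rfl
  | succ k ih => rw [network, ih]; rfl

/-- Hidden layers in which the activation function is replaced by multiplication with fixed
factors `s k i`. -/
noncomputable def frozenHidden (s : (k : ℕ) → Fin (ℓ k) → ℝ) (θ : Params ℓ L)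
    (x : EuclideanSpace ℝ (Fin (ℓ 0))) : (k : ℕ) → EuclideanSpace ℝ (Fin (ℓ k))
  | 0 => x
  | k + 1 => WithLp.toLp 2 fun i => s (k + 1) i * affine θ k (frozenHidden s θ x k) i

/-- The derivative of `frozenHidden` with respect to the parameters in direction `h`. -/
noncomputable def frozenDeriv (s : (k : ℕ) → Fin (ℓ k) → ℝ) (θ h : Params ℓ L)
    (x : EuclideanSpace ℝ (Fin (ℓ 0))) : (k : ℕ) → EuclideanSpace ℝ (Fin (ℓ k))
  | 0 => 0
  | k + 1 => WithLp.toLp 2 fun i => s (k + 1) i *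
      (affine h k (frozenHidden s θ x k) + linearPart θ k (frozenDeriv s θ h x k)) i

theorem norm_toLp_mul_le {n : ℕ} {s : Fin n → ℝ} (hs : ∀ i, |s i| ≤ 1)
    (v : EuclideanSpace ℝ (Fin n)) :
    ‖(WithLp.toLp 2 fun i => s i * v i : EuclideanSpace ℝ (Fin n))‖ ≤ ‖v‖ := by
  refine (sq_le_sq₀ (by positivity) (by positivity)).1 ?_
  rw [EuclideanSpace.norm_sq_eq, EuclideanSpace.norm_sq_eq]
  refine Finset.sum_le_sum fun i _ => ?_
  simp only [norm_mul, Real.norm_eq_abs]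
  refine pow_le_pow_left₀ (by positivity) ?_ 2
  exact mul_le_of_le_one_left (abs_nonneg _) (hs i)

/-- Because of the biases, the quantity that grows by at most a factor `A` per layer is the norm of
`(v, 1)`: `‖θ‖²(‖v‖²+1) + 1 ≤ (‖θ‖²+1)(‖v‖²+1)`. -/
theorem sqrt_norm_sq_add_one_le {m n : ℕ} {A Y : ℝ} {k : ℕ} (θ : Params ℓ L)
    (hA : ‖θ‖ ^ 2 + 1 ≤ A ^ 2) (hA0 : 0 ≤ A) (hY : 0 ≤ Y)
    (u : EuclideanSpace ℝ (Fin n)) (v : EuclideanSpace ℝ (Fin m))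
    (huv : ‖u‖ ^ 2 ≤ ‖θ‖ ^ 2 * (‖v‖ ^ 2 + 1)) (hv : √(‖v‖ ^ 2 + 1) ≤ A ^ k * Y) :
    √(‖u‖ ^ 2 + 1) ≤ A ^ (k + 1) * Y := by
  rw [Real.sqrt_le_left (by positivity)] at hv ⊢
  have h1 : ‖u‖ ^ 2 + 1 ≤ A ^ 2 * (‖v‖ ^ 2 + 1) := by nlinarith [sq_nonneg ‖v‖, sq_nonneg ‖θ‖]
  calc _ ≤ A ^ 2 * (‖v‖ ^ 2 + 1) := h1
    _ ≤ A ^ 2 * (A ^ k * Y) ^ 2 := by gcongr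
    _ = _ := by ring

theorem sqrt_norm_frozenHidden_le {s : (k : ℕ) → Fin (ℓ k) → ℝ} (hs : ∀ k i, |s k i| ≤ 1)
    {θ : Params ℓ L} {x : EuclideanSpace ℝ (Fin (ℓ 0))} {A Y : ℝ}
    (hA : ‖θ‖ ^ 2 + 1 ≤ A ^ 2) (hA0 : 0 ≤ A) (hY : √(‖x‖ ^ 2 + 1) ≤ Y) (k : ℕ) :
    √(‖frozenHidden s θ x k‖ ^ 2 + 1) ≤ A ^ k * Y := by
  induction k with
  | zero => simpa [frozenHidden] using hY
  | succ k ih =>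
    refine sqrt_norm_sq_add_one_le θ hA hA0 ((Real.sqrt_nonneg _).trans hY) _
      (frozenHidden s θ x k) ?_ ih
    exact le_trans (pow_le_pow_left₀ (norm_nonneg _) (norm_toLp_mul_le (hs (k + 1)) _) 2)
      (norm_sq_affine_le θ k _)

/-- The common induction step: the current layer contributes `1` and the earlier layers `k` to the
factor `k + 1`. The bound on `v` carries a factor `A` to avoid the exponent `k - 1`. -/
theorem norm_affine_add_linearPart_le {θ h : Params ℓ L} {A Y : ℝ} (k : ℕ)
    (hA : ‖θ‖ ≤ A) {u v : EuclideanSpace ℝ (Fin (ℓ k))}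
    (hu : √(‖u‖ ^ 2 + 1) ≤ A ^ k * Y) (hv : A * ‖v‖ ≤ k * A ^ k * Y * ‖h‖) :
    ‖affine h k u + linearPart θ k v‖ ≤ (k + 1) * A ^ k * Y * ‖h‖ := by
  have h1 := norm_affine_le h k u
  have h2 := norm_linearPart_le θ k v
  have h3 : ‖h‖ * √(‖u‖ ^ 2 + 1) ≤ ‖h‖ * (A ^ k * Y) := by gcongr
  have h4 : ‖θ‖ * ‖v‖ ≤ A * ‖v‖ := by gcongr
  linarith [norm_add_le (affine h k u) (linearPart θ k v)]

theorem mul_norm_frozenDeriv_le {s : (k : ℕ) → Fin (ℓ k) → ℝ} (hs : ∀ k i, |s k i| ≤ 1)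
    {θ : Params ℓ L} {x : EuclideanSpace ℝ (Fin (ℓ 0))} {A Y : ℝ}
    (hA : ‖θ‖ ^ 2 + 1 ≤ A ^ 2) (hA0 : 0 ≤ A) (hY : √(‖x‖ ^ 2 + 1) ≤ Y) (h : Params ℓ L) (k : ℕ) :
    A * ‖frozenDeriv s θ h x k‖ ≤ k * A ^ k * Y * ‖h‖ := by
  induction k with
  | zero => simp [frozenDeriv]
  | succ k ih =>
    have hA1 : ‖θ‖ ≤ A := abs_le_of_sq_le_sq' (by linarith) hA0 |>.2
    have h1 := norm_affine_add_linearPart_le k hA1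
      (sqrt_norm_frozenHidden_le hs hA hA0 hY k) ih
    have h2 := (norm_toLp_mul_le (hs (k + 1))
      (affine h k (frozenHidden s θ x k) + linearPart θ k (frozenDeriv s θ h x k))).trans h1
    calc A * ‖frozenDeriv s θ h x (k + 1)‖ ≤ A * ((k + 1) * A ^ k * Y * ‖h‖) :=
          mul_le_mul_of_nonneg_left h2 hA0
      _ = _ := by push_cast; ring

/-- The derivative of the output of the network with frozen activations is bounded. -/
theorem norm_outputDeriv_le {s : (k : ℕ) → Fin (ℓ k) → ℝ} (hs : ∀ k i, |s k i| ≤ 1)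
    {θ : Params ℓ L} {x : EuclideanSpace ℝ (Fin (ℓ 0))} {A Y : ℝ}
    (hA : ‖θ‖ ^ 2 + 1 ≤ A ^ 2) (hA0 : 0 ≤ A) (hY : √(‖x‖ ^ 2 + 1) ≤ Y) (h : Params ℓ L) (k : ℕ) :
    ‖affine h k (frozenHidden s θ x k) + linearPart θ k (frozenDeriv s θ h x k)‖
      ≤ (k + 1) * A ^ k * Y * ‖h‖ :=
  norm_affine_add_linearPart_le k (abs_le_of_sq_le_sq' (by linarith) hA0).2
    (sqrt_norm_frozenHidden_le hs hA hA0 hY k) (mul_norm_frozenDeriv_le hs hA hA0 hY h k)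

/-! ### The ReLU network -/

/-- The activation pattern of the ReLU network. -/
noncomputable def pattern (θ : Params ℓ L) (x : EuclideanSpace ℝ (Fin (ℓ 0))) (k : ℕ)
    (i : Fin (ℓ k)) : ℝ :=
  if 0 < network reluActivation θ x k i then 1 else 0

theorem abs_pattern_le (θ : Params ℓ L) (x : EuclideanSpace ℝ (Fin (ℓ 0))) (k : ℕ)
    (i : Fin (ℓ k)) : |pattern θ x k i| ≤ 1 := by
  unfold pattern; split_ifs <;> simp

theorem frozenHidden_pattern (θ : Params ℓ L) (x : EuclideanSpace ℝ (Fin (ℓ 0))) (k : ℕ) :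
    frozenHidden (pattern θ x) θ x k = hidden reluActivation θ x k := by
  induction k with
  | zero => rfl
  | succ k ih =>
    ext i
    simp only [frozenHidden, hidden, componentwise, ih, pattern, network_succ, reluActivation]
    split_ifs with h
    · rw [one_mul, max_eq_left h.le]
    · rw [zero_mul, max_eq_right (not_lt.1 h)]

theorem sqrt_norm_hidden_le {θ : Params ℓ L} {x : EuclideanSpace ℝ (Fin (ℓ 0))} {A Y : ℝ}
    (hA : ‖θ‖ ^ 2 + 1 ≤ A ^ 2) (hA0 : 0 ≤ A) (hY : √(‖x‖ ^ 2 + 1) ≤ Y) (k : ℕ) :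
    √(‖hidden reluActivation θ x k‖ ^ 2 + 1) ≤ A ^ k * Y := by
  rw [← frozenHidden_pattern]
  exact sqrt_norm_frozenHidden_le (abs_pattern_le θ x) hA hA0 hY k

theorem norm_network_le {θ : Params ℓ L} {x : EuclideanSpace ℝ (Fin (ℓ 0))} {A Y : ℝ}
    (hA : ‖θ‖ ^ 2 + 1 ≤ A ^ 2) (hA0 : 0 ≤ A) (hY : √(‖x‖ ^ 2 + 1) ≤ Y) (k : ℕ) :
    ‖network reluActivation θ x (k + 1)‖ ≤ A ^ (k + 1) * Y := by
  rw [network_succ]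
  have h := sqrt_norm_sq_add_one_le θ hA hA0 ((Real.sqrt_nonneg _).trans hY) _ _
    (norm_sq_affine_le θ k (hidden reluActivation θ x k)) (sqrt_norm_hidden_le hA hA0 hY k)
  refine le_trans (Real.le_sqrt_of_sq_le ?_) h
  linarith

theorem norm_relu_sub_le {n : ℕ} (u v : EuclideanSpace ℝ (Fin n)) (k : ℕ) :
    ‖componentwise (reluActivation k) u - componentwise (reluActivation k) v‖ ≤ ‖u - v‖ := by
  refine (sq_le_sq₀ (by positivity) (by positivity)).1 ?_
  rw [EuclideanSpace.norm_sq_eq, EuclideanSpace.norm_sq_eq]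
  refine Finset.sum_le_sum fun i _ => pow_le_pow_left₀ (norm_nonneg _) ?_ 2
  exact abs_max_sub_max_le_abs (u i) (v i) 0

/-- The activation patterns of `θ` and `η` may differ, so the frozen derivative bound does not
apply; instead ReLU is 1-Lipschitz. -/
theorem mul_norm_hidden_sub_le {θ η : Params ℓ L} {x : EuclideanSpace ℝ (Fin (ℓ 0))} {A Y : ℝ}
    (hθ : ‖θ‖ ^ 2 + 1 ≤ A ^ 2) (hη : ‖η‖ ^ 2 + 1 ≤ A ^ 2) (hA0 : 0 ≤ A)
    (hY : √(‖x‖ ^ 2 + 1) ≤ Y) (k : ℕ) :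
    A * ‖hidden reluActivation θ x k - hidden reluActivation η x k‖
      ≤ k * A ^ k * Y * ‖θ - η‖ := by
  induction k with
  | zero => simp [hidden]
  | succ k ih =>
    have h1 := norm_affine_add_linearPart_le (θ := θ) k
      (abs_le_of_sq_le_sq' (by linarith) hA0).2 (sqrt_norm_hidden_le hη hA0 hY k) ih
    rw [← affine_sub_affine] at h1
    calc _ ≤ A * ((k + 1) * A ^ k * Y * ‖θ - η‖) :=
          mul_le_mul_of_nonneg_left ((norm_relu_sub_le _ _ _).trans h1) hA0
      _ = _ := by push_cast; ring

/-- The ReLU network is Lipschitz continuous in the parameters on bounded sets. -/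
theorem norm_network_sub_le {θ η : Params ℓ L} {x : EuclideanSpace ℝ (Fin (ℓ 0))} {A Y : ℝ}
    (hθ : ‖θ‖ ^ 2 + 1 ≤ A ^ 2) (hη : ‖η‖ ^ 2 + 1 ≤ A ^ 2) (hA0 : 0 ≤ A)
    (hY : √(‖x‖ ^ 2 + 1) ≤ Y) (k : ℕ) :
    ‖network reluActivation θ x (k + 1) - network reluActivation η x (k + 1)‖
      ≤ (k + 1) * A ^ k * Y * ‖θ - η‖ := by
  rw [network_succ, network_succ, affine_sub_affine]
  exact norm_affine_add_linearPart_le k (abs_le_of_sq_le_sq' (by linarith) hA0).2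
    (sqrt_norm_hidden_le hη hA0 hY k) (mul_norm_hidden_sub_le hθ hη hA0 hY k)

/-! ### Differentiation with frozen activations -/

theorem contDiff_affine {k : ℕ} {v : Params ℓ L → EuclideanSpace ℝ (Fin (ℓ k))}
    (hv : ContDiff ℝ 1 v) : ContDiff ℝ 1 fun θ => affine θ k (v θ) := by
  refine (contDiff_piLp 2).2 fun i => ?_
  simp only [affine_apply]
  refine (contDiff_coord _).add (ContDiff.sum fun j _ => (contDiff_coord _).mul ?_)
  exact (contDiff_piLp 2).1 hv j

theorem contDiff_frozenHidden (s : (k : ℕ) → Fin (ℓ k) → ℝ) (x : EuclideanSpace ℝ (Fin (ℓ 0)))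
    (k : ℕ) : ContDiff ℝ 1 fun θ : Params ℓ L => frozenHidden s θ x k := by
  induction k with
  | zero => exact contDiff_const
  | succ k ih =>
    refine (contDiff_piLp 2).2 fun i => contDiff_const.mul ?_
    exact (contDiff_piLp 2).1 (contDiff_affine ih) i

theorem hasDerivAt_coord_line (θ h : Params ℓ L) (n : ℕ) :
    HasDerivAt (fun t : ℝ => coord (θ + t • h) n) (coord h n) 0 := by
  simp only [coord_add, coord_smul]
  simpa using ((hasDerivAt_id (0 : ℝ)).mul_const (coord h n)).const_add (coord θ n)

theorem hasDerivAt_affine_line {k : ℕ} {θ h : Params ℓ L} {v : ℝ → EuclideanSpace ℝ (Fin (ℓ k))}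
    {v' : EuclideanSpace ℝ (Fin (ℓ k))} (hv : ∀ j, HasDerivAt (fun t => v t j) (v' j) 0)
    (i : Fin (ℓ (k + 1))) :
    HasDerivAt (fun t : ℝ => affine (θ + t • h) k (v t) i)
      ((affine h k (v 0) + linearPart θ k v') i) 0 := by
  simp only [affine_apply, PiLp.add_apply, linearPart_apply]
  have h1 := (hasDerivAt_coord_line θ h (biasIndex ℓ k i)).add (HasDerivAt.fun_sum (u := Finset.univ)
    fun (j : Fin (ℓ k)) _ => (hasDerivAt_coord_line θ h (weightIndex ℓ k i j)).mul (hv j))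
  refine h1.congr_deriv ?_
  simp only [zero_smul, add_zero, Finset.sum_add_distrib]
  ring

theorem hasDerivAt_frozenHidden_line (s : (k : ℕ) → Fin (ℓ k) → ℝ)
    (x : EuclideanSpace ℝ (Fin (ℓ 0))) (θ h : Params ℓ L) (k : ℕ) (i : Fin (ℓ k)) :
    HasDerivAt (fun t : ℝ => frozenHidden s (θ + t • h) x k i) (frozenDeriv s θ h x k i) 0 := by
  induction k with
  | zero => exact hasDerivAt_const (0 : ℝ) (x i)
  | succ k ih =>
    have h1 := (hasDerivAt_affine_line (θ := θ) (h := h)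
      (v := fun t => frozenHidden s (θ + t • h) x k) ih i).const_mul (s (k + 1) i)
    simpa [frozenHidden, frozenDeriv] using h1

/-- The empirical risk with the activation patterns frozen at the parameter `θ₀`. -/
noncomputable def frozenRisk {k : ℕ} (ξ : EuclideanSpace ℝ (Fin (ℓ (k + 1)))) (M : ℕ)
    (x : ℕ → EuclideanSpace ℝ (Fin (ℓ 0))) (θ₀ θ : Params ℓ (k + 1)) : ℝ :=
  1 / (M : ℝ) * ∑ m ∈ Finset.Icc 1 M,
    ‖affine θ k (frozenHidden (pattern θ₀ (x m)) θ (x m) k) - ξ‖ ^ 2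

/-- The generalized gradient of the empirical risk of the ReLU network. -/
noncomputable def riskGradient {k : ℕ} (ξ : EuclideanSpace ℝ (Fin (ℓ (k + 1)))) (M : ℕ)
    (x : ℕ → EuclideanSpace ℝ (Fin (ℓ 0))) (θ : Params ℓ (k + 1)) : Params ℓ (k + 1) :=
  gradient (frozenRisk ξ M x θ) θ

theorem contDiff_frozenRisk {k : ℕ} (ξ : EuclideanSpace ℝ (Fin (ℓ (k + 1)))) (M : ℕ)
    (x : ℕ → EuclideanSpace ℝ (Fin (ℓ 0))) (θ₀ : Params ℓ (k + 1)) :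
    ContDiff ℝ 1 (frozenRisk ξ M x θ₀) :=
  contDiff_const.mul <| ContDiff.sum fun _ _ =>
    ((contDiff_affine (contDiff_frozenHidden _ _ k)).sub contDiff_const).norm_sq ℝ

/-- The derivative of the output of the ReLU network in direction `h`, with frozen activations. -/
noncomputable def outputDeriv (θ h : Params ℓ L) (x : EuclideanSpace ℝ (Fin (ℓ 0))) (k : ℕ) :
    EuclideanSpace ℝ (Fin (ℓ (k + 1))) :=
  affine h k (frozenHidden (pattern θ x) θ x k)
    + linearPart θ k (frozenDeriv (pattern θ x) θ h x k)

/-- Both sides are the derivative of the frozen risk along `t ↦ θ + t • h` at `0`. -/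
theorem inner_riskGradient {k : ℕ} (ξ : EuclideanSpace ℝ (Fin (ℓ (k + 1)))) (M : ℕ)
    (x : ℕ → EuclideanSpace ℝ (Fin (ℓ 0))) (θ h : Params ℓ (k + 1)) :
    inner ℝ (riskGradient ξ M x θ) h = 1 / (M : ℝ) * ∑ m ∈ Finset.Icc 1 M,
      2 * inner ℝ (network reluActivation θ (x m) (k + 1) - ξ) (outputDeriv θ h (x m) k) := by
  have hd : DifferentiableAt ℝ (frozenRisk ξ M x θ) θ :=
    (contDiff_frozenRisk ξ M x θ).differentiable one_ne_zero θ
  have h1 : HasDerivAt (fun t : ℝ => frozenRisk ξ M x θ (θ + t • h))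
      (inner ℝ (riskGradient ξ M x θ) h) 0 := by
    have h2 : HasDerivAt (fun t : ℝ => θ + t • h) h 0 := by
      simpa using ((hasDerivAt_id (0 : ℝ)).smul_const h).const_add θ
    have h3 := hd.hasGradientAt.hasFDerivAt
    have h4 : HasFDerivAt (frozenRisk ξ M x θ)
      (InnerProductSpace.toDual ℝ _ (gradient (frozenRisk ξ M x θ) θ)) (θ + (0 : ℝ) • h) := by
      simpa using h3
    exact h4.comp_hasDerivAt 0 h2
  refine h1.unique ?_
  simp only [frozenRisk, EuclideanSpace.norm_sq_eq, Real.norm_eq_abs, sq_abs]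
  refine (HasDerivAt.fun_sum fun m _ => ?_).const_mul _
  have h5 := HasDerivAt.fun_sum (u := Finset.univ) fun (i : Fin (ℓ (k + 1))) _ =>
    ((hasDerivAt_affine_line (θ := θ) (h := h)
      (v := fun t => frozenHidden (pattern θ (x m)) (θ + t • h) (x m) k)
      (hasDerivAt_frozenHidden_line _ _ θ h k) i).sub_const (ξ i)).fun_pow 2
  refine h5.congr_deriv ?_
  rw [network_succ, ← frozenHidden_pattern, PiLp.inner_apply, Finset.mul_sum]
  refine Finset.sum_congr rfl fun i _ => ?_
  simp [outputDeriv]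
  ring

/-! ### The limit of the gradients of the approximations -/

/-- For large `r` no preactivation at `θ` lies in the window `[1/(2s), 1/s]`, `s = r^{1/k}`, where
`R s` is neither zero nor the identity. A nonpositive preactivation, including `0`, falls strictly
below the window. By continuity this persists near `θ`, so gradients agree too, not only values. -/
theorem eventually_hidden_eq_frozenHidden {R : ℝ → ℝ → ℝ} (hR : IsReLUApproximation R)
    (θ : Params ℓ L) (x : EuclideanSpace ℝ (Fin (ℓ 0))) (k : ℕ) :
    ∀ᶠ r in atTop, ∀ᶠ η in 𝓝 θ,
      hidden (approxActivation R r) η x k = frozenHidden (pattern θ x) η x k := by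
  induction k with
  | zero => exact Eventually.of_forall fun r => Eventually.of_forall fun η => rfl
  | succ k ih =>
    have key : ∀ i : Fin (ℓ (k + 1)), ∀ᶠ r in atTop, ∀ᶠ η in 𝓝 θ,
        approxActivation R r (k + 1) (affine η k (frozenHidden (pattern θ x) η x k) i)
          = pattern θ x (k + 1) i * affine η k (frozenHidden (pattern θ x) η x k) i := by
      intro i
      have hcont : ContinuousAt
          (fun η : Params ℓ L => affine η k (frozenHidden (pattern θ x) η x k) i) θ :=
        (((contDiff_piLp 2).1 (contDiff_affine (contDiff_frozenHidden (pattern θ x) x k)) i).continuous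
          ).continuousAt
      have hval : affine θ k (frozenHidden (pattern θ x) θ x k) i
          = network reluActivation θ x (k + 1) i := by
        rw [network_succ, frozenHidden_pattern]
      have hexp : (0 : ℝ) < 1 / ((k + 1 : ℕ) : ℝ) := by positivity
      have hlim := tendsto_rpow_atTop hexp
      by_cases hz : 0 < network reluActivation θ x (k + 1) i
      · have hlim0 := tendsto_inv_atTop_zero.comp hlim
        filter_upwards [hlim.eventually_ge_atTop 1, hlim0.eventually_lt_const hz] with r hr1 hr2
        rw [← hval] at hr2
        filter_upwards [hcont.eventually_const_lt hr2] with η hη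
        rw [approxActivation, hR.eq_self _ hr1 _ hη.le, pattern, if_pos hz, one_mul]
      · filter_upwards [hlim.eventually_ge_atTop 1] with r hr1
        have hlt : affine θ k (frozenHidden (pattern θ x) θ x k) i
            < 2⁻¹ * (r ^ (1 / ((k + 1 : ℕ) : ℝ)))⁻¹ := by
          rw [hval]
          exact (not_lt.1 hz).trans_lt (by positivity)
        filter_upwards [hcont.eventually_lt_const hlt] with η hη
        rw [approxActivation, hR.eq_zero _ hr1 _ hη.le, pattern, if_neg hz, zero_mul]
    filter_upwards [ih, eventually_all.2 key] with r h1 h2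
    filter_upwards [h1, eventually_all.2 h2] with η h3 h4
    ext i
    simp only [hidden, frozenHidden, componentwise, h3, h4]

theorem eventually_gradient_eq {R : ℝ → ℝ → ℝ} (hR : IsReLUApproximation R) {k : ℕ}
    (ξ : EuclideanSpace ℝ (Fin (ℓ (k + 1)))) (M : ℕ)
    (x : ℕ → EuclideanSpace ℝ (Fin (ℓ 0))) (θ : Params ℓ (k + 1)) :
    ∀ᶠ r in atTop, gradient (empiricalRisk (approxActivation R r) ξ M x) θ
      = riskGradient ξ M x θ := by
  have h := (eventually_all_finset (Finset.Icc 1 M)).2 fun m _ =>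
    eventually_hidden_eq_frozenHidden hR θ (x m) k
  filter_upwards [h] with r hr
  refine Filter.EventuallyEq.gradient_eq ?_
  filter_upwards [(eventually_all_finset (Finset.Icc 1 M)).2 hr] with η hη
  rw [empiricalRisk, frozenRisk]
  congr 1
  refine Finset.sum_congr rfl fun m hm => ?_
  rw [network_succ, hη m hm]

theorem tendsto_gradient_riskGradient {R : ℝ → ℝ → ℝ} (hR : IsReLUApproximation R) {k : ℕ}
    (ξ : EuclideanSpace ℝ (Fin (ℓ (k + 1)))) (M : ℕ)
    (x : ℕ → EuclideanSpace ℝ (Fin (ℓ 0))) (θ : Params ℓ (k + 1)) :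
    Tendsto (fun r => gradient (empiricalRisk (approxActivation R r) ξ M x) θ) atTop
      (𝓝 (riskGradient ξ M x θ)) :=
  tendsto_const_nhds.congr' ((eventually_gradient_eq hR ξ M x θ).mono fun _ h => h.symm)

/-- The limit exists at every point, so `G` is determined everywhere. -/
theorem IsGeneralizedGradient.eq_riskGradient {R : ℝ → ℝ → ℝ} (hR : IsReLUApproximation R)
    {k : ℕ} {Ω : Type*} [MeasurableSpace Ω] {ξ : EuclideanSpace ℝ (Fin (ℓ (k + 1)))} {M : ℕ → ℕ}
    {X : ℕ → ℕ → Ω → EuclideanSpace ℝ (Fin (ℓ 0))}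
    {G : ℕ → Params ℓ (k + 1) → Ω → Params ℓ (k + 1)} (hG : IsGeneralizedGradient R ξ M X G)
    (n : ℕ) (θ : Params ℓ (k + 1)) (ω : Ω) :
    G n θ ω = riskGradient ξ (M n) (fun m => X n m ω) θ :=
  have h := tendsto_gradient_riskGradient hR ξ (M n) (fun m => X n m ω) θ
  tendsto_nhds_unique (hG n θ ω ⟨_, h⟩) h

/-! ### Measurability of the generalized gradient -/

theorem continuous_affine {T : Type*} [TopologicalSpace T] {k : ℕ} {θ : T → Params ℓ L}
    {v : T → EuclideanSpace ℝ (Fin (ℓ k))} (hθ : Continuous θ) (hv : Continuous v) :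
    Continuous fun t => affine (θ t) k (v t) := by
  refine (PiLp.continuous_toLp 2 _).comp (continuous_pi fun i => ?_)
  have hc : ∀ n, Continuous fun t => coord (θ t) n := fun n =>
    (contDiff_coord n).continuous.comp hθ
  refine (hc (biasIndex ℓ k i)).add ?_
  change Continuous fun t => ∑ j : Fin (ℓ k), coord (θ t) (weightIndex ℓ k i j) * v t j
  exact (continuous_finsetSum _ fun j _ => (hc _).mul
    ((EuclideanSpace.proj j).continuous.comp hv))

theorem continuous_hidden {σ : ℕ → ℝ → ℝ} (hσ : ∀ k, Continuous (σ (k + 1))) {T : Type*}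
    [TopologicalSpace T] {θ : T → Params ℓ L} {x : T → EuclideanSpace ℝ (Fin (ℓ 0))}
    (hθ : Continuous θ) (hx : Continuous x) (k : ℕ) :
    Continuous fun t => hidden σ (θ t) (x t) k := by
  induction k with
  | zero => exact hx
  | succ k ih =>
    refine (PiLp.continuous_toLp 2 _).comp (continuous_pi fun i => (hσ k).comp ?_)
    exact (EuclideanSpace.proj i).continuous.comp (continuous_affine hθ ih)

theorem continuous_network {σ : ℕ → ℝ → ℝ} (hσ : ∀ k, Continuous (σ (k + 1))) {T : Type*}
    [TopologicalSpace T] {θ : T → Params ℓ L} {x : T → EuclideanSpace ℝ (Fin (ℓ 0))}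
    (hθ : Continuous θ) (hx : Continuous x) (k : ℕ) :
    Continuous fun t => network σ (θ t) (x t) (k + 1) := by
  simp only [network_succ]
  exact continuous_affine hθ (continuous_hidden hσ hθ hx k)

/-- The pattern is discontinuous in `θ`, so the gradient is obtained as a pointwise limit of
gradients of continuous parametrized risks, which are jointly measurable. -/
theorem measurable_riskGradient {R : ℝ → ℝ → ℝ} (hR : IsReLUApproximation R) {k : ℕ}
    (ξ : EuclideanSpace ℝ (Fin (ℓ (k + 1)))) (M : ℕ) :
    Measurable fun p : (ℕ → EuclideanSpace ℝ (Fin (ℓ 0))) × Params ℓ (k + 1) =>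
      riskGradient ξ M p.1 p.2 := by
  -- The shift `n + 1` keeps the index in `[1, ∞)`.
  refine measurable_of_tendsto_metrizable (f := fun (n : ℕ)
    (p : (ℕ → EuclideanSpace ℝ (Fin (ℓ 0))) × Params ℓ (k + 1)) =>
      gradient (empiricalRisk (approxActivation R ((n : ℝ) + 1)) ξ M p.1) p.2) (fun n => ?_) ?_
  · have hσ : ∀ j, Continuous (approxActivation R ((n : ℝ) + 1) (j + 1)) := fun j =>
      (hR.contDiff _ (Real.one_le_rpow (by linarith [n.cast_nonneg (α := ℝ)])
        (by positivity))).continuous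
    have hc : Continuous (Function.uncurry
        fun (x : ℕ → EuclideanSpace ℝ (Fin (ℓ 0))) (θ : Params ℓ (k + 1)) =>
          empiricalRisk (approxActivation R ((n : ℝ) + 1)) ξ M x θ) := by
      refine continuous_const.mul (continuous_finsetSum _ fun m _ => ?_)
      exact ((continuous_network hσ continuous_snd
        ((continuous_apply m).comp continuous_fst) k).sub continuous_const).norm.pow 2
    exact (InnerProductSpace.toDual ℝ (Params ℓ (k + 1))).symm.continuous.measurable.comp
      (measurable_fderiv_with_param ℝ hc)
  · refine tendsto_pi_nhds.2 fun p => ?_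
    exact (tendsto_gradient_riskGradient hR ξ M p.1 p.2).comp
      (tendsto_atTop_add_const_right _ 1 tendsto_natCast_atTop_atTop)

variable {K : ℕ}

/-! ### The Lyapunov function -/

theorem numParams_mono (ℓ : ℕ → ℕ) : Monotone (numParams ℓ) := fun _ _ h =>
  Finset.sum_le_sum_of_subset (Finset.range_mono h)

theorem numParams_succ (ℓ : ℕ → ℕ) (k : ℕ) :
    numParams ℓ (k + 1) = numParams ℓ k + ℓ (k + 1) * ℓ k + ℓ (k + 1) := by
  rw [numParams, Finset.sum_range_succ, ← numParams]; ring

/-- The weight `k + 1` for biases in the affine layer with number `k` (counted from `0`), and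
`1` for all other parameters. -/
def lyapunovWeight (ℓ : ℕ → ℕ) (K n : ℕ) : ℕ :=
  if h : ∃ k, k ≤ K ∧ numParams ℓ k + ℓ (k + 1) * ℓ k ≤ n ∧ n < numParams ℓ (k + 1)
    then Nat.find h + 1 else 1

theorem one_le_lyapunovWeight (ℓ : ℕ → ℕ) (K n : ℕ) : 1 ≤ lyapunovWeight ℓ K n := by
  unfold lyapunovWeight; split_ifs <;> omega

theorem lyapunovWeight_le (ℓ : ℕ → ℕ) (K n : ℕ) : lyapunovWeight ℓ K n ≤ K + 1 := by
  unfold lyapunovWeight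
  split_ifs with h
  · exact Nat.succ_le_succ (Nat.find_spec h).1
  · omega

theorem layer_unique {n k k' : ℕ} (h1 : numParams ℓ k ≤ n) (h2 : n < numParams ℓ (k + 1))
    (h3 : numParams ℓ k' ≤ n) (h4 : n < numParams ℓ (k' + 1)) : k = k' := by
  rcases lt_trichotomy k k' with h | h | h
  · have := numParams_mono ℓ (show k + 1 ≤ k' from h); omega
  · exact h
  · have := numParams_mono ℓ (show k' + 1 ≤ k from h); omega

theorem lyapunovWeight_weightIndex {k : ℕ} (i : Fin (ℓ (k + 1))) (j : Fin (ℓ k)) :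
    lyapunovWeight ℓ K (weightIndex ℓ k i j) = 1 := by
  have h1 := weight_offset_lt i j
  have h2 := numParams_succ ℓ k
  refine dif_neg ?_
  rintro ⟨k', -, h3, h4⟩
  obtain rfl : k = k' := layer_unique (n := weightIndex ℓ k i j) (by unfold weightIndex; omega)
    (by unfold weightIndex; omega) (by omega) h4
  unfold weightIndex at h3
  omega

theorem lyapunovWeight_biasIndex {k : ℕ} (hk : k ≤ K) (i : Fin (ℓ (k + 1))) :
    lyapunovWeight ℓ K (biasIndex ℓ k i) = k + 1 := by
  have h2 := numParams_succ ℓ k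
  have hi := i.2
  have h : ∃ k', k' ≤ K ∧ numParams ℓ k' + ℓ (k' + 1) * ℓ k' ≤ biasIndex ℓ k i
      ∧ biasIndex ℓ k i < numParams ℓ (k' + 1) :=
    ⟨k, hk, by unfold biasIndex; omega, by unfold biasIndex; omega⟩
  rw [lyapunovWeight, dif_pos h]
  obtain ⟨-, h3, h4⟩ := Nat.find_spec h
  congr 1
  exact layer_unique (n := biasIndex ℓ k i) (by omega) h4 (by unfold biasIndex; omega)
    (by unfold biasIndex; omega)

/-- The coordinates of the parameter vector with bias `ξ` in the last layer and all other
parameters equal to zero. -/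
noncomputable def targetCoord (ξ : EuclideanSpace ℝ (Fin (ℓ (K + 1)))) (n : ℕ) : ℝ :=
  if numParams ℓ K + ℓ (K + 1) * ℓ K ≤ n then
    if h : n - (numParams ℓ K + ℓ (K + 1) * ℓ K) < ℓ (K + 1) then ξ ⟨_, h⟩ else 0
  else 0

theorem targetCoord_of_lt (ξ : EuclideanSpace ℝ (Fin (ℓ (K + 1)))) {n : ℕ}
    (h : n < numParams ℓ K + ℓ (K + 1) * ℓ K) : targetCoord ξ n = 0 :=
  if_neg (not_le.2 h)

theorem targetCoord_weightIndex (ξ : EuclideanSpace ℝ (Fin (ℓ (K + 1)))) {k : ℕ} (hk : k ≤ K)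
    (i : Fin (ℓ (k + 1))) (j : Fin (ℓ k)) : targetCoord ξ (weightIndex ℓ k i j) = 0 := by
  have h1 := weight_offset_lt i j
  have h2 := numParams_succ ℓ k
  refine targetCoord_of_lt ξ ?_
  unfold weightIndex
  rcases hk.lt_or_eq with h | rfl
  · have := numParams_mono ℓ (show k + 1 ≤ K from h)
    omega
  · omega

theorem targetCoord_biasIndex_of_lt (ξ : EuclideanSpace ℝ (Fin (ℓ (K + 1)))) {k : ℕ} (hk : k < K)
    (i : Fin (ℓ (k + 1))) : targetCoord ξ (biasIndex ℓ k i) = 0 := by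
  have h2 := numParams_succ ℓ k
  have h3 := numParams_mono ℓ (show k + 1 ≤ K from hk)
  have hi := i.2
  refine targetCoord_of_lt ξ ?_
  unfold biasIndex
  omega

theorem targetCoord_add (ξ : EuclideanSpace ℝ (Fin (ℓ (K + 1)))) (i : Fin (ℓ (K + 1))) :
    targetCoord ξ (numParams ℓ K + ℓ (K + 1) * ℓ K + i) = ξ i := by
  simp [targetCoord]

theorem targetCoord_biasIndex (ξ : EuclideanSpace ℝ (Fin (ℓ (K + 1)))) (i : Fin (ℓ (K + 1))) :
    targetCoord ξ (biasIndex ℓ K i) = ξ i := by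
  rw [← targetCoord_add ξ i, biasIndex]
  congr 1
  omega

/-- The parameter vector with bias `ξ` in the last layer and all other parameters equal to zero. -/
noncomputable def targetParams (ξ : EuclideanSpace ℝ (Fin (ℓ (K + 1)))) : Params ℓ (K + 1) :=
  WithLp.toLp 2 fun i => targetCoord ξ i

theorem norm_targetParams (ξ : EuclideanSpace ℝ (Fin (ℓ (K + 1)))) : ‖targetParams ξ‖ = ‖ξ‖ := by
  rw [EuclideanSpace.norm_eq, EuclideanSpace.norm_eq]
  congr 1
  simp only [targetParams]
  rw [← Finset.sum_range (fun n => ‖targetCoord ξ n‖ ^ 2), numParams_succ,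
    Finset.sum_range_add, Finset.sum_eq_zero, zero_add, Finset.sum_range]
  · simp only [targetCoord_add]
  · intro n hn
    rw [targetCoord_of_lt ξ (Finset.mem_range.1 hn)]
    simp

/-- Half of the gradient of the Lyapunov function. -/
noncomputable def lyapunovDir (ξ : EuclideanSpace ℝ (Fin (ℓ (K + 1)))) (θ : Params ℓ (K + 1)) :
    Params ℓ (K + 1) :=
  WithLp.toLp 2 fun i => (lyapunovWeight ℓ K i : ℝ) * (θ - targetParams ξ) i

/-- The Lyapunov function. -/
noncomputable def lyapunov (ξ : EuclideanSpace ℝ (Fin (ℓ (K + 1)))) (θ : Params ℓ (K + 1)) : ℝ :=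
  ∑ i : Fin (numParams ℓ (K + 1)), (lyapunovWeight ℓ K i : ℝ) * ((θ - targetParams ξ) i) ^ 2

theorem coord_lyapunovDir (ξ : EuclideanSpace ℝ (Fin (ℓ (K + 1)))) (θ : Params ℓ (K + 1)) {n : ℕ}
    (hn : n < numParams ℓ (K + 1)) :
    coord (lyapunovDir ξ θ) n = (lyapunovWeight ℓ K n : ℝ) * (coord θ n - targetCoord ξ n) := by
  simp [coord, hn, lyapunovDir, targetParams]

/-- Euler's identity for one layer: the bias has degree `k + 1`, and `W v` has degree `1 + k` when
`v` has degree `k`. -/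
theorem affine_lyapunovDir_of_lt (ξ : EuclideanSpace ℝ (Fin (ℓ (K + 1)))) (θ : Params ℓ (K + 1))
    {k : ℕ} (hk : k < K) (v : EuclideanSpace ℝ (Fin (ℓ k))) :
    affine (lyapunovDir ξ θ) k v + linearPart θ k ((k : ℝ) • v)
      = ((k + 1 : ℕ) : ℝ) • affine θ k v := by
  ext i
  simp only [PiLp.add_apply, PiLp.smul_apply, affine_apply, linearPart_apply, smul_eq_mul]
  rw [coord_lyapunovDir ξ θ (biasIndex_lt ℓ (by omega) i.2), lyapunovWeight_biasIndex hk.le,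
    targetCoord_biasIndex_of_lt ξ hk]
  have h : ∀ j : Fin (ℓ k), coord (lyapunovDir ξ θ) (weightIndex ℓ k i j)
      = coord θ (weightIndex ℓ k i j) := fun j => by
    rw [coord_lyapunovDir ξ θ (weightIndex_lt ℓ (by omega) i.2 j.2), lyapunovWeight_weightIndex,
      targetCoord_weightIndex ξ hk.le]
    simp
  simp only [h, mul_left_comm _ (k : ℝ), ← Finset.mul_sum]
  push_cast
  ring

/-- The same identity, with the shifted last bias contributing `-(K+1) ξ`. -/
theorem affine_lyapunovDir_last (ξ : EuclideanSpace ℝ (Fin (ℓ (K + 1)))) (θ : Params ℓ (K + 1))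
    (v : EuclideanSpace ℝ (Fin (ℓ K))) :
    affine (lyapunovDir ξ θ) K v + linearPart θ K ((K : ℝ) • v)
      = ((K + 1 : ℕ) : ℝ) • (affine θ K v - ξ) := by
  ext i
  simp only [PiLp.add_apply, PiLp.sub_apply, PiLp.smul_apply, affine_apply, linearPart_apply,
    smul_eq_mul]
  rw [coord_lyapunovDir ξ θ (biasIndex_lt ℓ (by omega) i.2), lyapunovWeight_biasIndex le_rfl,
    targetCoord_biasIndex ξ]
  have h : ∀ j : Fin (ℓ K), coord (lyapunovDir ξ θ) (weightIndex ℓ K i j)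
      = coord θ (weightIndex ℓ K i j) := fun j => by
    rw [coord_lyapunovDir ξ θ (weightIndex_lt ℓ (by omega) i.2 j.2), lyapunovWeight_weightIndex,
      targetCoord_weightIndex ξ le_rfl]
    simp
  simp only [h, mul_left_comm _ (K : ℝ), ← Finset.mul_sum]
  push_cast
  ring

theorem frozenDeriv_lyapunovDir (s : (k : ℕ) → Fin (ℓ k) → ℝ)
    (ξ : EuclideanSpace ℝ (Fin (ℓ (K + 1)))) (θ : Params ℓ (K + 1))
    (x : EuclideanSpace ℝ (Fin (ℓ 0))) (k : ℕ) (hk : k ≤ K) :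
    frozenDeriv s θ (lyapunovDir ξ θ) x k = (k : ℝ) • frozenHidden s θ x k := by
  induction k with
  | zero => simp [frozenDeriv]
  | succ k ih =>
    ext i
    simp only [frozenDeriv, frozenHidden, PiLp.smul_apply, smul_eq_mul]
    rw [ih (by omega), affine_lyapunovDir_of_lt ξ θ hk, PiLp.smul_apply, smul_eq_mul]
    ring

theorem outputDeriv_lyapunovDir (ξ : EuclideanSpace ℝ (Fin (ℓ (K + 1)))) (θ : Params ℓ (K + 1))
    (x : EuclideanSpace ℝ (Fin (ℓ 0))) :
    outputDeriv θ (lyapunovDir ξ θ) x K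
      = ((K + 1 : ℕ) : ℝ) • (network reluActivation θ x (K + 1) - ξ) := by
  rw [outputDeriv, frozenDeriv_lyapunovDir _ ξ θ x K le_rfl, affine_lyapunovDir_last,
    frozenHidden_pattern, network_succ]

/-- The derivative of the Lyapunov function in the direction of the generalized gradient is a
multiple of the empirical risk. -/
theorem inner_riskGradient_lyapunovDir (ξ : EuclideanSpace ℝ (Fin (ℓ (K + 1)))) (M : ℕ)
    (x : ℕ → EuclideanSpace ℝ (Fin (ℓ 0))) (θ : Params ℓ (K + 1)) :
    inner ℝ (riskGradient ξ M x θ) (lyapunovDir ξ θ)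
      = 2 * (K + 1) * empiricalRisk reluActivation ξ M x θ := by
  rw [inner_riskGradient, empiricalRisk, mul_left_comm (2 * ((K : ℝ) + 1))]
  congr 1
  rw [Finset.mul_sum]
  refine Finset.sum_congr rfl fun m _ => ?_
  rw [outputDeriv_lyapunovDir, inner_smul_right, real_inner_self_eq_norm_sq]
  push_cast
  ring

theorem empiricalRisk_nonneg (ξ : EuclideanSpace ℝ (Fin (ℓ (K + 1)))) (M : ℕ)
    (x : ℕ → EuclideanSpace ℝ (Fin (ℓ 0))) (θ : Params ℓ (K + 1)) :
    0 ≤ empiricalRisk reluActivation ξ M x θ := by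
  unfold empiricalRisk; positivity

/-- Pair the gradient `g` with itself; Young's inequality leaves `‖g‖²/2` on the right, which is
absorbed. -/
theorem norm_sq_riskGradient_le (ξ : EuclideanSpace ℝ (Fin (ℓ (K + 1)))) {M : ℕ} (hM : 1 ≤ M)
    {x : ℕ → EuclideanSpace ℝ (Fin (ℓ 0))} {θ : Params ℓ (K + 1)} {A Y : ℝ}
    (hA : ‖θ‖ ^ 2 + 1 ≤ A ^ 2) (hA0 : 0 ≤ A) (hY : ∀ m, √(‖x m‖ ^ 2 + 1) ≤ Y) :
    ‖riskGradient ξ M x θ‖ ^ 2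
      ≤ 4 * ((K + 1) * A ^ K * Y) ^ 2 * empiricalRisk reluActivation ξ M x θ := by
  set g := riskGradient ξ M x θ with hg
  have h1 := inner_riskGradient ξ M x θ g
  rw [← hg, real_inner_self_eq_norm_sq] at h1
  have hM0 : (M : ℝ) ≠ 0 := by positivity
  have h2 : ‖g‖ ^ 2 ≤ 1 / (M : ℝ) * ∑ m ∈ Finset.Icc 1 M, (2 * ((K + 1) * A ^ K * Y) ^ 2 *
      ‖network reluActivation θ (x m) (K + 1) - ξ‖ ^ 2 + ‖g‖ ^ 2 / 2) := by
    rw [h1]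
    gcongr with m _
    have h3 := real_inner_le_norm (network reluActivation θ (x m) (K + 1) - ξ)
      (outputDeriv θ g (x m) K)
    have h4 := norm_outputDeriv_le (abs_pattern_le θ (x m)) hA hA0 (hY m) g K
    have h5 := mul_le_mul_of_nonneg_left h4
      (norm_nonneg (network reluActivation θ (x m) (K + 1) - ξ))
    rw [outputDeriv] at h3 ⊢
    -- The earlier rewrite also expanded the `‖g‖²` on the right; this folds it back. The square
    -- below is Young's inequality.
    rw [← h1]
    nlinarith [sq_nonneg (2 * ((K + 1) * A ^ K * Y *
      ‖network reluActivation θ (x m) (K + 1) - ξ‖) - ‖g‖)]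
  rw [Finset.sum_add_distrib, ← Finset.mul_sum, Finset.sum_const, Nat.card_Icc, mul_add,
    Nat.add_sub_cancel, nsmul_eq_mul, mul_left_comm, ← mul_assoc (1 / (M : ℝ)) (M : ℝ),
    one_div_mul_cancel hM0] at h2
  rw [empiricalRisk]
  linarith

theorem norm_sq_sub_le_lyapunov (ξ : EuclideanSpace ℝ (Fin (ℓ (K + 1)))) (θ : Params ℓ (K + 1)) :
    ‖θ - targetParams ξ‖ ^ 2 ≤ lyapunov ξ θ := by
  rw [EuclideanSpace.norm_sq_eq, lyapunov]
  refine Finset.sum_le_sum fun i _ => ?_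
  rw [Real.norm_eq_abs, sq_abs]
  exact le_mul_of_one_le_left (sq_nonneg _) (mod_cast one_le_lyapunovWeight ℓ K i)

theorem lyapunovWeighted_sq_le (η : Params ℓ (K + 1)) :
    ∑ i : Fin (numParams ℓ (K + 1)), (lyapunovWeight ℓ K i : ℝ) * (η i) ^ 2
      ≤ (K + 1) * ‖η‖ ^ 2 := by
  rw [EuclideanSpace.norm_sq_eq, Finset.mul_sum]
  refine Finset.sum_le_sum fun i _ => ?_
  rw [Real.norm_eq_abs, sq_abs]
  exact mul_le_mul_of_nonneg_right (mod_cast lyapunovWeight_le ℓ K i) (sq_nonneg _)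

/-- The function is quadratic, so its second-order expansion is exact; the weights in the last term
are at most `K + 1`. -/
theorem lyapunov_sub_smul_le (ξ : EuclideanSpace ℝ (Fin (ℓ (K + 1)))) (θ g : Params ℓ (K + 1))
    (γ : ℝ) : lyapunov ξ (θ - γ • g)
      ≤ lyapunov ξ θ - 2 * γ * inner ℝ g (lyapunovDir ξ θ) + γ ^ 2 * ((K + 1) * ‖g‖ ^ 2) := by
  have h : lyapunov ξ (θ - γ • g) = lyapunov ξ θ - 2 * γ * inner ℝ g (lyapunovDir ξ θ)
      + γ ^ 2 * ∑ i : Fin (numParams ℓ (K + 1)), (lyapunovWeight ℓ K i : ℝ) * (g i) ^ 2 := by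
    rw [lyapunov, lyapunov, PiLp.inner_apply, Finset.mul_sum, Finset.mul_sum,
      ← Finset.sum_sub_distrib, ← Finset.sum_add_distrib]
    refine Finset.sum_congr rfl fun i _ => ?_
    simp [lyapunovDir]
    ring
  rw [h]
  gcongr
  exact lyapunovWeighted_sq_le g

/-- The linear term gives `-4(K+1)γe`, with `e` the empirical risk, and the step size keeps the
quadratic term below `(K+1)γe`. -/
theorem lyapunov_step_le (ξ : EuclideanSpace ℝ (Fin (ℓ (K + 1)))) {M : ℕ} (hM : 1 ≤ M)
    {x : ℕ → EuclideanSpace ℝ (Fin (ℓ 0))} {θ : Params ℓ (K + 1)} {A Y γ : ℝ}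
    (hA : ‖θ‖ ^ 2 + 1 ≤ A ^ 2) (hA0 : 0 ≤ A) (hY : ∀ m, √(‖x m‖ ^ 2 + 1) ≤ Y) (hγ : 0 ≤ γ)
    (hγ1 : 4 * ((K + 1) * A ^ K * Y) ^ 2 * γ ≤ 1) :
    lyapunov ξ (θ - γ • riskGradient ξ M x θ)
      ≤ lyapunov ξ θ - 3 * (K + 1) * (γ * empiricalRisk reluActivation ξ M x θ) := by
  have h1 := lyapunov_sub_smul_le ξ θ (riskGradient ξ M x θ) γ
  rw [inner_riskGradient_lyapunovDir] at h1
  have h2 := norm_sq_riskGradient_le ξ hM hA hA0 hY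
  set e := empiricalRisk reluActivation ξ M x θ
  have he : 0 ≤ e := empiricalRisk_nonneg ξ M x θ
  have h3 : γ * ‖riskGradient ξ M x θ‖ ^ 2 ≤ e := by
    calc _ ≤ γ * (4 * ((K + 1) * A ^ K * Y) ^ 2 * e) := by gcongr
      _ = (4 * ((K + 1) * A ^ K * Y) ^ 2 * γ) * e := by ring
      _ ≤ 1 * e := by gcongr
      _ = e := one_mul e
  have h4 : γ ^ 2 * ((K + 1) * ‖riskGradient ξ M x θ‖ ^ 2) ≤ (K + 1) * (γ * e) := by
    calc _ = (K + 1) * (γ * (γ * ‖riskGradient ξ M x θ‖ ^ 2)) := by ring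
      _ ≤ _ := by gcongr
  linarith

/-! ### Trajectories of stochastic gradient descent -/

theorem lyapunov_le (ξ : EuclideanSpace ℝ (Fin (ℓ (K + 1)))) (θ : Params ℓ (K + 1)) {c : ℝ}
    (hξ : ‖ξ‖ ≤ c) : lyapunov ξ θ ≤ (K + 1) * (‖θ‖ + c) ^ 2 := by
  refine (lyapunovWeighted_sq_le (θ - targetParams ξ)).trans ?_
  gcongr
  exact (norm_sub_le _ _).trans (by rw [norm_targetParams]; gcongr)

/-- With `Q = (c(‖η‖+1))²`, the terms are at most `2(K+1)Q`, `2Q` and `Q`, whence the factor 5. -/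
theorem norm_sq_add_one_le_of_lyapunov_le (ξ : EuclideanSpace ℝ (Fin (ℓ (K + 1))))
    {θ η : Params ℓ (K + 1)} {c : ℝ} (hξ : ‖ξ‖ ≤ c) (hc : 1 ≤ c)
    (h : lyapunov ξ θ ≤ lyapunov ξ η) :
    ‖θ‖ ^ 2 + 1 ≤ 5 * (K + 1) * (c * (‖η‖ + 1)) ^ 2 := by
  have h1 := norm_sq_sub_le_lyapunov ξ θ
  have h2 := lyapunov_le ξ η hξ
  have h3 : ‖θ‖ ≤ ‖θ - targetParams ξ‖ + c := by
    have := norm_add_le (θ - targetParams ξ) (targetParams ξ)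
    rw [sub_add_cancel, norm_targetParams] at this
    linarith
  have h4 : ‖θ‖ ^ 2 ≤ 2 * ‖θ - targetParams ξ‖ ^ 2 + 2 * c ^ 2 := by
    nlinarith [norm_nonneg θ, sq_nonneg (‖θ - targetParams ξ‖ - c),
      pow_le_pow_left₀ (norm_nonneg θ) h3 2]
  have h5 : ‖η‖ + c ≤ c * (‖η‖ + 1) := by nlinarith [norm_nonneg η]
  have h6 : (‖η‖ + c) ^ 2 ≤ (c * (‖η‖ + 1)) ^ 2 := by gcongr
  have h7 : c ≤ c * (‖η‖ + 1) := by nlinarith [norm_nonneg η]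
  have h8 : c ^ 2 ≤ (c * (‖η‖ + 1)) ^ 2 := by gcongr
  have h9 : (1 : ℝ) ≤ c ^ 2 := one_le_pow₀ hc
  have hK : (0 : ℝ) ≤ K := K.cast_nonneg
  nlinarith [mul_le_mul_of_nonneg_left h6 (by positivity : (0 : ℝ) ≤ K + 1)]

/-- Here `T` stands for `‖θ 0‖ + 1`. The `K` factors `A²` and the remaining prefactor are each at
most `(4(K+1)DcT)²`, which gives the exponent `2(K+1)`. -/
theorem stepSize_bound {K : ℕ} {A D T c γ : ℝ} (hD : 1 ≤ D) (hT : 1 ≤ T) (hc : 1 ≤ c)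
    (hA : A ^ 2 = 5 * (K + 1) * (c * T) ^ 2) (hγ : 0 ≤ γ)
    (h : (4 * (K + 1) * D * c) ^ (2 * (K + 1)) * γ ≤ (T ^ (2 * (K + 1)))⁻¹) :
    4 * ((K + 1) * A ^ K * √(D * c ^ 2)) ^ 2 * γ ≤ 1 := by
  have hK : (0 : ℝ) ≤ K := K.cast_nonneg
  have hP : (4 * (K + 1) * D * c * T) ^ (2 * (K + 1)) * γ ≤ 1 := by
    rw [mul_pow _ T]
    have hT0 : 0 < T ^ (2 * (K + 1)) := by positivity
    calc _ = T ^ (2 * (K + 1)) * ((4 * (K + 1) * D * c) ^ (2 * (K + 1)) * γ) := by ring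
      _ ≤ T ^ (2 * (K + 1)) * (T ^ (2 * (K + 1)))⁻¹ := by gcongr
      _ = 1 := mul_inv_cancel₀ hT0.ne'
  refine le_trans (mul_le_mul_of_nonneg_right ?_ hγ) hP
  have hT2 : 1 ≤ T ^ 2 := one_le_pow₀ hT
  have hc2 : 1 ≤ c ^ 2 := one_le_pow₀ hc
  have hD2 : D ≤ D ^ 2 := by nlinarith
  calc 4 * ((K + 1) * A ^ K * √(D * c ^ 2)) ^ 2
      = 4 * (K + 1) ^ 2 * (D * c ^ 2) * (A ^ 2) ^ K := by
        rw [mul_pow, Real.sq_sqrt (by positivity)]; ring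
    _ ≤ (16 * (K + 1) ^ 2 * D ^ 2 * c ^ 2 * T ^ 2)
          * (16 * (K + 1) ^ 2 * D ^ 2 * c ^ 2 * T ^ 2) ^ K := by
        rw [hA]
        gcongr ?_ * ?_ ^ K
        · calc 4 * ((K : ℝ) + 1) ^ 2 * (D * c ^ 2) = 4 * (K + 1) ^ 2 * D * c ^ 2 * 1 := by ring
            _ ≤ 16 * (K + 1) ^ 2 * D ^ 2 * c ^ 2 * T ^ 2 := by gcongr; norm_num
        · calc 5 * ((K : ℝ) + 1) * (c * T) ^ 2 = 5 * ((K + 1) * 1) * 1 * c ^ 2 * T ^ 2 := by ring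
            _ ≤ 16 * ((K + 1) * (K + 1)) * D ^ 2 * c ^ 2 * T ^ 2 := by
              gcongr
              · norm_num
              · linarith
              · nlinarith
            _ = _ := by ring
    _ = _ := by rw [pow_mul]; ring

theorem trajectory_step {ξ : EuclideanSpace ℝ (Fin (ℓ (K + 1)))} {M : ℕ → ℕ} (hM : ∀ n, 1 ≤ M n)
    {x : ℕ → ℕ → EuclideanSpace ℝ (Fin (ℓ 0))} {θ : ℕ → Params ℓ (K + 1)} {c D : ℝ} {γ : ℕ → ℝ}
    (hξ : ‖ξ‖ ≤ c) (hc : 1 ≤ c) (hD : 1 ≤ D) (hx : ∀ n m, √(‖x n m‖ ^ 2 + 1) ≤ √(D * c ^ 2))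
    (hγ : ∀ n, 0 ≤ γ n)
    (hγ1 : ∀ n, (4 * (K + 1) * D * c) ^ (2 * (K + 1)) * γ n ≤ ((‖θ 0‖ + 1) ^ (2 * (K + 1)))⁻¹)
    (hθ : ∀ n, θ (n + 1) = θ n - γ n • riskGradient ξ (M n) (x n) (θ n)) (n : ℕ)
    (hn : lyapunov ξ (θ n) ≤ lyapunov ξ (θ 0)) :
    lyapunov ξ (θ (n + 1)) ≤ lyapunov ξ (θ n)
      - 3 * (K + 1) * (γ n * empiricalRisk reluActivation ξ (M n) (x n) (θ n)) := by
  have hA2 : (√(5 * (K + 1) * (c * (‖θ 0‖ + 1)) ^ 2)) ^ 2 = 5 * (K + 1) * (c * (‖θ 0‖ + 1)) ^ 2 :=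
    Real.sq_sqrt (by positivity)
  rw [hθ n]
  refine lyapunov_step_le ξ (hM n) (A := √(5 * (K + 1) * (c * (‖θ 0‖ + 1)) ^ 2))
    ?_ (Real.sqrt_nonneg _) (hx n) (hγ n) ?_
  · rw [hA2]; exact norm_sq_add_one_le_of_lyapunov_le ξ hξ hc hn
  · exact stepSize_bound hD (by linarith [norm_nonneg (θ 0)]) hc hA2 (hγ n) (hγ1 n)

/-- The Lyapunov function is nonincreasing along trajectories, and controls the empirical risks. -/
theorem trajectory_lyapunov_le {ξ : EuclideanSpace ℝ (Fin (ℓ (K + 1)))} {M : ℕ → ℕ}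
    (hM : ∀ n, 1 ≤ M n)
    {x : ℕ → ℕ → EuclideanSpace ℝ (Fin (ℓ 0))} {θ : ℕ → Params ℓ (K + 1)} {c D : ℝ} {γ : ℕ → ℝ}
    (hξ : ‖ξ‖ ≤ c) (hc : 1 ≤ c) (hD : 1 ≤ D) (hx : ∀ n m, √(‖x n m‖ ^ 2 + 1) ≤ √(D * c ^ 2))
    (hγ : ∀ n, 0 ≤ γ n)
    (hγ1 : ∀ n, (4 * (K + 1) * D * c) ^ (2 * (K + 1)) * γ n ≤ ((‖θ 0‖ + 1) ^ (2 * (K + 1)))⁻¹)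
    (hθ : ∀ n, θ (n + 1) = θ n - γ n • riskGradient ξ (M n) (x n) (θ n)) (n : ℕ) :
    lyapunov ξ (θ n) + 3 * (K + 1) * ∑ k ∈ Finset.range n,
      γ k * empiricalRisk reluActivation ξ (M k) (x k) (θ k) ≤ lyapunov ξ (θ 0) := by
  induction n with
  | zero => simp
  | succ n ih =>
    have h0 : 0 ≤ 3 * ((K : ℝ) + 1) * ∑ k ∈ Finset.range n,
        γ k * empiricalRisk reluActivation ξ (M k) (x k) (θ k) :=
      mul_nonneg (by positivity) (Finset.sum_nonneg fun k _ =>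
        mul_nonneg (hγ k) (empiricalRisk_nonneg _ _ _ _))
    have h := trajectory_step hM hξ hc hD hx hγ hγ1 hθ n (by linarith)
    rw [Finset.sum_range_succ]
    linarith

theorem lyapunov_nonneg (ξ : EuclideanSpace ℝ (Fin (ℓ (K + 1)))) (θ : Params ℓ (K + 1)) :
    0 ≤ lyapunov ξ θ :=
  (sq_nonneg _).trans (norm_sq_sub_le_lyapunov ξ θ)

/-! ### General facts -/

/-- Divergence of `∑ γ` makes `u` drop below any `ε` infinitely often. While `u > ε`, a decrease of
at most `Cγ` costs at most `(C/ε)γu`, so a descent from a large value would use up more than the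
small tail of `∑ γu`. -/
theorem tendsto_zero_of_summable_mul {u γ : ℕ → ℝ} {C : ℝ} (hu : ∀ n, 0 ≤ u n)
    (hγ : ∀ n, 0 ≤ γ n) (hγ_sum : Tendsto (fun N => ∑ k ∈ Finset.range N, γ k) atTop atTop)
    (hsum : Summable fun n => γ n * u n) (hstep : ∀ n, u n - u (n + 1) ≤ C * γ n) :
    Tendsto u atTop (𝓝 0) := by
  have hstep' : ∀ n, u n - u (n + 1) ≤ |C| * γ n := fun n =>
    (hstep n).trans (mul_le_mul_of_nonneg_right (le_abs_self C) (hγ n))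
  have hfreq : ∀ ε > 0, ∀ n, ∃ m, n ≤ m ∧ u m < ε := by
    intro ε hε n
    by_contra! hcon
    have h1 : Summable fun k => γ (k + n) := by
      refine Summable.of_nonneg_of_le (fun k => hγ _) (fun k => ?_)
        (((summable_nat_add_iff n).2 hsum).mul_left ε⁻¹)
      rw [← div_eq_inv_mul, le_div_iff₀ hε]
      exact mul_le_mul_of_nonneg_left (hcon _ (Nat.le_add_left _ _)) (hγ _)
    have h2 : Summable γ := (summable_nat_add_iff n).1 h1
    exact not_tendsto_nhds_of_tendsto_atTop hγ_sum _ h2.hasSum.tendsto_sum_nat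
  -- Truncation at `ε` makes the steps with `u ≤ ε` free.
  have hdrop : ∀ ε > 0, ∀ n m, n ≤ m →
      max (u n - ε) 0 ≤ max (u m - ε) 0 + |C| / ε * ∑ k ∈ Finset.Ico n m, γ k * u k := by
    intro ε hε n m hnm
    induction m, hnm using Nat.le_induction with
    | base => simp
    | succ m hm ih =>
      rw [Finset.sum_Ico_succ_top hm, mul_add]
      have h1 : max (u m - ε) 0 ≤ max (u (m + 1) - ε) 0 + |C| / ε * (γ m * u m) := by
        have h0 : 0 ≤ |C| / ε * (γ m * u m) :=
          mul_nonneg (by positivity) (mul_nonneg (hγ m) (hu m))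
        rcases le_or_gt (u m) ε with h | h
        · rw [max_eq_right (by linarith)]
          positivity
        · rw [max_eq_left (by linarith)]
          have h2 : |C| * γ m ≤ |C| / ε * (γ m * u m) := by
            rw [div_mul_eq_mul_div, le_div_iff₀ hε, mul_assoc]
            exact mul_le_mul_of_nonneg_left (mul_le_mul_of_nonneg_left h.le (hγ m)) (abs_nonneg C)
          linarith [hstep' m, le_max_left (u (m + 1) - ε) 0]
      linarith
  have htail : Tendsto (fun n => ∑' k, γ (k + n) * u (k + n)) atTop (𝓝 0) :=
    tendsto_sum_nat_add fun k => γ k * u k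
  rw [Metric.tendsto_atTop]
  intro ε hε
  have h2 : Tendsto (fun n => |C| / (ε / 2) * ∑' k, γ (k + n) * u (k + n)) atTop (𝓝 0) := by
    simpa using htail.const_mul (|C| / (ε / 2))
  obtain ⟨N, hN⟩ := eventually_atTop.1 (h2.eventually_lt_const (half_pos hε))
  refine ⟨N, fun n hn => ?_⟩
  rw [Real.dist_0_eq_abs, abs_of_nonneg (hu n)]
  -- At this later time the truncated value vanishes, so the tail alone bounds `u n - ε / 2`.
  obtain ⟨m, hm, hum⟩ := hfreq (ε / 2) (half_pos hε) n
  have h3 := hdrop (ε / 2) (half_pos hε) n m hm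
  have h4 : ∑ k ∈ Finset.Ico n m, γ k * u k ≤ ∑' k, γ (k + n) * u (k + n) := by
    rw [Finset.sum_Ico_eq_sum_range]
    simp only [add_comm n]
    exact ((summable_nat_add_iff n).2 hsum).sum_le_tsum _
      fun k _ => mul_nonneg (hγ _) (hu _)
  rw [max_eq_right (by linarith : u m - ε / 2 ≤ 0)] at h3
  have h5 := mul_le_mul_of_nonneg_left h4 (by positivity : 0 ≤ |C| / (ε / 2))
  linarith [hN n hn, le_max_left (u n - ε / 2) 0]

/-- By Tonelli the infinite sum has finite expectation, so it is finite almost surely. -/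
theorem ae_summable_of_sum_integral_le {Ω : Type*} [MeasurableSpace Ω] {P : Measure Ω}
    {g : ℕ → Ω → ℝ} {B : ℝ} (hg : ∀ n, Integrable (g n) P) (hg0 : ∀ n ω, 0 ≤ g n ω)
    (hB : ∀ N, ∑ n ∈ Finset.range N, ∫ ω, g n ω ∂P ≤ B) : ∀ᵐ ω ∂P, Summable fun n => g n ω := by
  have h1 : ∫⁻ ω, ∑' n, ENNReal.ofReal (g n ω) ∂P ≠ ⊤ := by
    rw [lintegral_tsum fun n => (hg n).aemeasurable.ennreal_ofReal]
    simp only [← ofReal_integral_eq_lintegral_ofReal (hg _) (ae_of_all _ (hg0 _))]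
    exact (summable_of_sum_range_le (fun n => integral_nonneg (hg0 n)) hB).tsum_ofReal_ne_top
  filter_upwards [ae_lt_top' (AEMeasurable.tsum
    fun n => (hg n).aemeasurable.ennreal_ofReal) h1] with ω hω
  have h2 := ENNReal.summable_toReal hω.ne
  simpa only [ENNReal.toReal_ofReal (hg0 _ _)] using h2

/-- The joint law is `U ⊗ (Y ⊗ Z)`; reassociate the product. -/
theorem indepFun_prodMk_left {Ω α β δ : Type*} [MeasurableSpace Ω] [MeasurableSpace α]
    [MeasurableSpace β] [MeasurableSpace δ] {P : Measure Ω} [IsProbabilityMeasure P]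
    {U : Ω → α} {Y : Ω → β} {Z : Ω → δ} (hU : Measurable U) (hY : Measurable Y)
    (hZ : Measurable Z) (h : IndepFun U (fun ω => (Y ω, Z ω)) P) (hYZ : IndepFun Y Z P) :
    IndepFun (fun ω => (U ω, Y ω)) Z P := by
  have := Measure.isProbabilityMeasure_map (μ := P) hU.aemeasurable
  have := Measure.isProbabilityMeasure_map (μ := P) hY.aemeasurable
  have := Measure.isProbabilityMeasure_map (μ := P) hZ.aemeasurable
  have hUY : IndepFun U Y P := h.comp measurable_id measurable_fst
  have h1 := (indepFun_iff_map_prod_eq_prod_map_map hU.aemeasurable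
    (hY.prodMk hZ).aemeasurable).1 h
  have h2 := (indepFun_iff_map_prod_eq_prod_map_map hY.aemeasurable hZ.aemeasurable).1 hYZ
  have h3 := (indepFun_iff_map_prod_eq_prod_map_map hU.aemeasurable hY.aemeasurable).1 hUY
  refine (indepFun_iff_map_prod_eq_prod_map_map (hU.prodMk hY).aemeasurable hZ.aemeasurable).2 ?_
  apply (MeasurableEquiv.prodAssoc (α := α) (β := β) (γ := δ)).map_measurableEquiv_injective
  rw [h3, Measure.prodAssoc_prod, ← h2, ← h1,
    Measure.map_map (MeasurableEquiv.measurable _) ((hU.prodMk hY).prodMk hZ)]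
  rfl

/-! ### The risk -/

/-- The squared error of the ReLU network. -/
noncomputable def sqError (ξ : EuclideanSpace ℝ (Fin (ℓ (K + 1)))) (θ : Params ℓ (K + 1))
    (x : EuclideanSpace ℝ (Fin (ℓ 0))) : ℝ :=
  ‖network reluActivation θ x (K + 1) - ξ‖ ^ 2

theorem continuous_sqError (ξ : EuclideanSpace ℝ (Fin (ℓ (K + 1)))) :
    Continuous fun p : Params ℓ (K + 1) × EuclideanSpace ℝ (Fin (ℓ 0)) => sqError ξ p.1 p.2 :=
  ((continuous_network (fun _ => continuous_id.max continuous_const) continuous_fst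
    continuous_snd K).sub continuous_const).norm.pow 2

theorem sqError_nonneg (ξ : EuclideanSpace ℝ (Fin (ℓ (K + 1)))) (θ : Params ℓ (K + 1))
    (x : EuclideanSpace ℝ (Fin (ℓ 0))) : 0 ≤ sqError ξ θ x := sq_nonneg _

theorem norm_network_sub_target_le {ξ : EuclideanSpace ℝ (Fin (ℓ (K + 1)))}
    {θ : Params ℓ (K + 1)} {x : EuclideanSpace ℝ (Fin (ℓ 0))} {A Y c : ℝ}
    (hA : ‖θ‖ ^ 2 + 1 ≤ A ^ 2) (hA0 : 0 ≤ A) (hY : √(‖x‖ ^ 2 + 1) ≤ Y) (hξ : ‖ξ‖ ≤ c) :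
    ‖network reluActivation θ x (K + 1) - ξ‖ ≤ A ^ (K + 1) * Y + c :=
  (norm_sub_le _ _).trans (add_le_add (norm_network_le hA hA0 hY K) hξ)

theorem sqError_le {ξ : EuclideanSpace ℝ (Fin (ℓ (K + 1)))}
    {θ : Params ℓ (K + 1)} {x : EuclideanSpace ℝ (Fin (ℓ 0))} {A Y c : ℝ}
    (hA : ‖θ‖ ^ 2 + 1 ≤ A ^ 2) (hA0 : 0 ≤ A) (hY : √(‖x‖ ^ 2 + 1) ≤ Y) (hξ : ‖ξ‖ ≤ c) :
    sqError ξ θ x ≤ (A ^ (K + 1) * Y + c) ^ 2 :=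
  pow_le_pow_left₀ (norm_nonneg _) (norm_network_sub_target_le hA hA0 hY hξ) 2

theorem sqError_sub_le {ξ : EuclideanSpace ℝ (Fin (ℓ (K + 1)))}
    {θ η : Params ℓ (K + 1)} {x : EuclideanSpace ℝ (Fin (ℓ 0))} {A Y c : ℝ}
    (hθ : ‖θ‖ ^ 2 + 1 ≤ A ^ 2) (hη : ‖η‖ ^ 2 + 1 ≤ A ^ 2) (hA0 : 0 ≤ A)
    (hY : √(‖x‖ ^ 2 + 1) ≤ Y) (hξ : ‖ξ‖ ≤ c) :
    sqError ξ θ x - sqError ξ η x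
      ≤ ((K + 1) * A ^ K * Y) * (2 * (A ^ (K + 1) * Y + c)) * ‖θ - η‖ := by
  have h1 := norm_network_sub_target_le hθ hA0 hY hξ
  have h2 := norm_network_sub_target_le hη hA0 hY hξ
  have h3 := norm_network_sub_le hθ hη hA0 hY K
  have h4 := norm_sub_norm_le (network reluActivation θ x (K + 1) - ξ)
    (network reluActivation η x (K + 1) - ξ)
  rw [sub_sub_sub_cancel_right] at h4
  unfold sqError
  set p := ‖network reluActivation θ x (K + 1) - ξ‖
  set q := ‖network reluActivation η x (K + 1) - ξ‖
  have hp : 0 ≤ p := norm_nonneg _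
  have hq : 0 ≤ q := norm_nonneg _
  calc p ^ 2 - q ^ 2 = (p - q) * (p + q) := by ring
    _ ≤ ((K + 1) * A ^ K * Y * ‖θ - η‖) * (p + q) :=
        mul_le_mul_of_nonneg_right (h4.trans h3) (by positivity)
    _ ≤ ((K + 1) * A ^ K * Y * ‖θ - η‖) * (2 * (A ^ (K + 1) * Y + c)) :=
        mul_le_mul_of_nonneg_left (by linarith) ((norm_nonneg _).trans h3)
    _ = _ := by ring

theorem empiricalRisk_eq (ξ : EuclideanSpace ℝ (Fin (ℓ (K + 1)))) (M : ℕ)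
    (x : ℕ → EuclideanSpace ℝ (Fin (ℓ 0))) (θ : Params ℓ (K + 1)) :
    empiricalRisk reluActivation ξ M x θ
      = 1 / (M : ℝ) * ∑ m ∈ Finset.Icc 1 M, sqError ξ θ (x m) := rfl

theorem empiricalRisk_le {ξ : EuclideanSpace ℝ (Fin (ℓ (K + 1)))} {M : ℕ} (hM : 1 ≤ M)
    {x : ℕ → EuclideanSpace ℝ (Fin (ℓ 0))} {θ : Params ℓ (K + 1)} {A Y c : ℝ}
    (hA : ‖θ‖ ^ 2 + 1 ≤ A ^ 2) (hA0 : 0 ≤ A) (hY : ∀ m, √(‖x m‖ ^ 2 + 1) ≤ Y) (hξ : ‖ξ‖ ≤ c) :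
    empiricalRisk reluActivation ξ M x θ ≤ (A ^ (K + 1) * Y + c) ^ 2 := by
  have hM0 : (M : ℝ) ≠ 0 := by positivity
  have h := Finset.sum_le_card_nsmul (Finset.Icc 1 M) (fun m => sqError ξ θ (x m)) _
    fun m _ => sqError_le hA hA0 (hY m) hξ
  rw [Nat.card_Icc, Nat.add_sub_cancel, nsmul_eq_mul] at h
  rw [empiricalRisk_eq, one_div, inv_mul_le_iff₀ (by positivity)]
  exact h

section Probability

variable {Ω : Type*} [MeasurableSpace Ω] {P : Measure Ω}

theorem risk_nonneg (X : Ω → EuclideanSpace ℝ (Fin (ℓ 0))) (ξ : EuclideanSpace ℝ (Fin (ℓ (K + 1))))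
    (θ : Params ℓ (K + 1)) : 0 ≤ risk P X ξ θ :=
  integral_nonneg fun _ => sq_nonneg _

variable [IsProbabilityMeasure P]

theorem integrable_sqError {ξ : EuclideanSpace ℝ (Fin (ℓ (K + 1)))} {T : Ω → Params ℓ (K + 1)}
    {x : Ω → EuclideanSpace ℝ (Fin (ℓ 0))} {A Y c : ℝ} (hT : Measurable T) (hx : Measurable x)
    (hA : ∀ᵐ ω ∂P, ‖T ω‖ ^ 2 + 1 ≤ A ^ 2) (hA0 : 0 ≤ A) (hY : ∀ ω, √(‖x ω‖ ^ 2 + 1) ≤ Y)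
    (hξ : ‖ξ‖ ≤ c) : Integrable (fun ω => sqError ξ (T ω) (x ω)) P := by
  refine Integrable.of_bound
    ((continuous_sqError ξ).measurable.comp (hT.prodMk hx)).aestronglyMeasurable
    ((A ^ (K + 1) * Y + c) ^ 2) ?_
  filter_upwards [hA] with ω hω
  rw [Real.norm_eq_abs, abs_of_nonneg (sqError_nonneg _ _ _)]
  exact sqError_le hω hA0 (hY ω) hξ

theorem risk_le {X : Ω → EuclideanSpace ℝ (Fin (ℓ 0))} {ξ : EuclideanSpace ℝ (Fin (ℓ (K + 1)))}
    {θ : Params ℓ (K + 1)} {A Y c : ℝ} (hX : Measurable X)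
    (hA : ‖θ‖ ^ 2 + 1 ≤ A ^ 2) (hA0 : 0 ≤ A) (hY : ∀ ω, √(‖X ω‖ ^ 2 + 1) ≤ Y)
    (hξ : ‖ξ‖ ≤ c) : risk P X ξ θ ≤ (A ^ (K + 1) * Y + c) ^ 2 := by
  have h := integral_mono (μ := P)
    (integrable_sqError (T := fun _ => θ) measurable_const hX (ae_of_all _ fun _ => hA) hA0 hY hξ)
    (integrable_const ((A ^ (K + 1) * Y + c) ^ 2)) fun ω => sqError_le hA hA0 (hY ω) hξ
  rw [integral_const, probReal_univ, one_smul] at h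
  exact h

theorem risk_sub_le {X : Ω → EuclideanSpace ℝ (Fin (ℓ 0))} {ξ : EuclideanSpace ℝ (Fin (ℓ (K + 1)))}
    {θ η : Params ℓ (K + 1)} {A Y c : ℝ} (hX : Measurable X)
    (hθ : ‖θ‖ ^ 2 + 1 ≤ A ^ 2) (hη : ‖η‖ ^ 2 + 1 ≤ A ^ 2) (hA0 : 0 ≤ A)
    (hY : ∀ ω, √(‖X ω‖ ^ 2 + 1) ≤ Y) (hξ : ‖ξ‖ ≤ c) :
    risk P X ξ θ - risk P X ξ η
      ≤ ((K + 1) * A ^ K * Y) * (2 * (A ^ (K + 1) * Y + c)) * ‖θ - η‖ := by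
  have h1 := integrable_sqError (P := P) (T := fun _ => θ) measurable_const hX
    (ae_of_all _ fun _ => hθ) hA0 hY hξ
  have h2 := integrable_sqError (P := P) (T := fun _ => η) measurable_const hX
    (ae_of_all _ fun _ => hη) hA0 hY hξ
  have h := integral_mono (μ := P) (h1.sub h2) (integrable_const
    (((K + 1) * A ^ K * Y) * (2 * (A ^ (K + 1) * Y + c)) * ‖θ - η‖))
    fun ω => sqError_sub_le hθ hη hA0 (hY ω) hξ
  simp only [Pi.sub_apply] at h
  rw [integral_sub h1 h2, integral_const, probReal_univ, one_smul] at h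
  exact h

theorem measurable_risk {X : Ω → EuclideanSpace ℝ (Fin (ℓ 0))} (hX : Measurable X)
    (ξ : EuclideanSpace ℝ (Fin (ℓ (K + 1)))) : Measurable (risk P X ξ) := by
  have h : StronglyMeasurable fun p : Params ℓ (K + 1) × Ω => sqError ξ p.1 (X p.2) :=
    ((continuous_sqError ξ).measurable.comp
      (measurable_fst.prodMk (hX.comp measurable_snd))).stronglyMeasurable
  exact (h.integral_prod_right (ν := P)).measurable

theorem integrable_risk {X : Ω → EuclideanSpace ℝ (Fin (ℓ 0))}
    {ξ : EuclideanSpace ℝ (Fin (ℓ (K + 1)))} {T : Ω → Params ℓ (K + 1)}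
    {A Y c : ℝ} (hT : Measurable T) (hX : Measurable X)
    (hA : ∀ᵐ ω ∂P, ‖T ω‖ ^ 2 + 1 ≤ A ^ 2) (hA0 : 0 ≤ A) (hY : ∀ ω, √(‖X ω‖ ^ 2 + 1) ≤ Y)
    (hξ : ‖ξ‖ ≤ c) : Integrable (fun ω => risk P X ξ (T ω)) P := by
  refine Integrable.of_bound ((measurable_risk hX ξ).comp hT).aestronglyMeasurable
    ((A ^ (K + 1) * Y + c) ^ 2) ?_
  filter_upwards [hA] with ω hω
  rw [Real.norm_eq_abs, abs_of_nonneg (risk_nonneg _ _ _)]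
  exact risk_le hX hω hA0 hY hξ

/-- Independence makes the joint law a product; by Fubini, integrating out the data first gives the
risk. -/
theorem integral_sqError_eq_integral_risk {X X' : Ω → EuclideanSpace ℝ (Fin (ℓ 0))}
    {ξ : EuclideanSpace ℝ (Fin (ℓ (K + 1)))} {T : Ω → Params ℓ (K + 1)} (hT : Measurable T)
    (hX' : Measurable X') (hX : Measurable X) (hid : IdentDistrib X' X P P)
    (hind : IndepFun T X' P) (hint : Integrable (fun ω => sqError ξ (T ω) (X' ω)) P) :
    ∫ ω, sqError ξ (T ω) (X' ω) ∂P = ∫ ω, risk P X ξ (T ω) ∂P := by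
  have hmap := (indepFun_iff_map_prod_eq_prod_map_map hT.aemeasurable hX'.aemeasurable).1 hind
  have hf : Measurable fun p : Params ℓ (K + 1) × EuclideanSpace ℝ (Fin (ℓ 0)) =>
    sqError ξ p.1 p.2 := (continuous_sqError ξ).measurable
  have hTX := hT.prodMk hX'
  have := Measure.isProbabilityMeasure_map (μ := P) hT.aemeasurable
  have := Measure.isProbabilityMeasure_map (μ := P) hX'.aemeasurable
  calc ∫ ω, sqError ξ (T ω) (X' ω) ∂P
      = ∫ p, sqError ξ p.1 p.2 ∂(P.map fun ω => (T ω, X' ω)) :=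
        (integral_map hTX.aemeasurable hf.aestronglyMeasurable).symm
    _ = ∫ p, sqError ξ p.1 p.2 ∂((P.map T).prod (P.map X')) := by rw [hmap]
    _ = ∫ θ, ∫ x, sqError ξ θ x ∂(P.map X') ∂(P.map T) := by
        refine integral_prod _ ?_
        rw [← hmap]
        exact (integrable_map_measure hf.aestronglyMeasurable hTX.aemeasurable).2 hint
    _ = ∫ θ, risk P X ξ θ ∂(P.map T) := by
        congr 1
        ext θ
        rw [hid.map_eq, integral_map hX.aemeasurable
          (f := fun x => sqError ξ θ x) (hf.comp measurable_prodMk_left).aestronglyMeasurable]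
        rfl
    _ = _ := integral_map hT.aemeasurable (measurable_risk hX ξ).aestronglyMeasurable

/-! ### Independence of the iterates and the current data -/

/-- The σ-algebra on `Ω` is left free, and only batches before `n` need be measurable, so that it
can be applied to the σ-algebra of the past. -/
theorem measurable_iterate {Ω : Type*} [MeasurableSpace Ω]
    {ξ : EuclideanSpace ℝ (Fin (ℓ (K + 1)))} {R : ℝ → ℝ → ℝ}
    (hR : IsReLUApproximation R) {M : ℕ → ℕ} {X : ℕ → ℕ → Ω → EuclideanSpace ℝ (Fin (ℓ 0))}
    {Θ : ℕ → Ω → Params ℓ (K + 1)} {γ : ℕ → ℝ} {n : ℕ} (hΘ_meas : Measurable (Θ 0))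
    (hX : ∀ j < n, ∀ i, Measurable (X j i))
    (hΘ : ∀ n ω, Θ (n + 1) ω
      = Θ n ω - γ n • riskGradient ξ (M n) (fun m => X n m ω) (Θ n ω)) :
    ∀ j ≤ n, Measurable (Θ j) := by
  intro j hj
  induction j with
  | zero => exact hΘ_meas
  | succ j ih =>
    have hΘj := ih (by omega)
    rw [funext (hΘ j)]
    have hx : Measurable fun ω i => X j i ω := measurable_pi_iff.2 (hX j hj)
    have hg : Measurable fun ω => riskGradient ξ (M j) (fun i => X j i ω) (Θ j ω) :=
      Measurable.comp (g := fun p : (ℕ → EuclideanSpace ℝ (Fin (ℓ 0))) × Params ℓ (K + 1) =>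
        riskGradient ξ (M j) p.1 p.2) (f := fun ω => (fun i => X j i ω, Θ j ω))
        (measurable_riskGradient hR ξ (M j)) (hx.prodMk hΘj)
    exact hΘj.sub (hg.const_smul (γ j))

theorem indepFun_iterate {ξ : EuclideanSpace ℝ (Fin (ℓ (K + 1)))} {R : ℝ → ℝ → ℝ}
    (hR : IsReLUApproximation R) {M : ℕ → ℕ} {X : ℕ → ℕ → Ω → EuclideanSpace ℝ (Fin (ℓ 0))}
    (hX_meas : ∀ n m, Measurable (X n m)) (hX_indep : iIndepFun (fun p : ℕ × ℕ => X p.1 p.2) P)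
    {Θ : ℕ → Ω → Params ℓ (K + 1)} (hΘ_meas : Measurable (Θ 0)) {γ : ℕ → ℝ}
    (hΘ_indep : IndepFun (Θ 0) (fun ω (p : ℕ × ℕ) => X p.1 p.2 ω) P)
    (hΘ : ∀ n ω, Θ (n + 1) ω
      = Θ n ω - γ n • riskGradient ξ (M n) (fun m => X n m ω) (Θ n ω)) (n m : ℕ) :
    IndepFun (Θ n) (X n m) P := by
  let Y : Ω → ({p : ℕ × ℕ // p.1 < n} → EuclideanSpace ℝ (Fin (ℓ 0))) :=
    fun ω p => X p.1.1 p.1.2 ω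
  have hY : Measurable Y := measurable_pi_iff.2 fun p => hX_meas _ _
  have hYZ : IndepFun Y (X n m) P := by
    have h := indep_iSup_of_disjoint (fun p : ℕ × ℕ => (hX_meas p.1 p.2).comap_le) hX_indep
      (S := {p | p.1 < n}) (T := {(n, m)}) (by simp)
    refine indep_of_indep_of_le_left (indep_of_indep_of_le_right h ?_) ?_
    · exact le_iSup₂_of_le (n, m) rfl le_rfl
    · refine Measurable.comap_le (@measurable_pi_lambda _ _ _ (_) _ _ fun p => ?_)
      exact (comap_measurable (X p.1.1 p.1.2)).mono (le_iSup₂_of_le p.1 p.2 le_rfl) le_rfl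
  have hind : IndepFun (fun ω => (Θ 0 ω, Y ω)) (X n m) P := by
    refine indepFun_prodMk_left hΘ_meas hY (hX_meas n m) ?_ hYZ
    refine hΘ_indep.comp (ψ := fun x : ℕ × ℕ → EuclideanSpace ℝ (Fin (ℓ 0)) =>
      ((fun p : {p : ℕ × ℕ // p.1 < n} => x p.1), x (n, m))) measurable_id ?_
    exact (measurable_pi_iff.2 fun p => measurable_pi_apply _).prodMk (measurable_pi_apply _)
  have hc : Measurable[MeasurableSpace.comap (fun ω => (Θ 0 ω, Y ω)) inferInstance]
      (fun ω => (Θ 0 ω, Y ω)) := comap_measurable _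
  -- `Θ n` is measurable with respect to the σ-algebra generated by `Θ 0` and the batches before
  -- `n`.
  have hmeas := @measurable_iterate ℓ K Ω (MeasurableSpace.comap (fun ω => (Θ 0 ω, Y ω)) inferInstance)
    ξ R hR M X Θ γ n (measurable_fst.comp hc) (fun j hj i =>
      ((measurable_pi_apply (⟨(j, i), hj⟩ : {p : ℕ × ℕ // p.1 < n})).comp measurable_snd).comp hc)
    hΘ n le_rfl
  exact indep_of_indep_of_le_left hind hmeas.comap_le

end Probability

/-! ### Bounds on the data, and assembly of the proof -/

theorem succ_le_numParams (hℓ : ∀ k, 1 ≤ ℓ k) : ℓ 0 + 1 ≤ numParams ℓ (K + 1) := by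
  have h := numParams_succ_le ℓ (Nat.succ_pos K)
  have h1 := hℓ 1
  rw [zero_add] at h
  nlinarith

theorem sqrt_norm_sq_add_one_le_of_mem_Icc {a b c D : ℝ} (ha : |a| ≤ c) (hb : |b| ≤ c)
    (hc : 1 ≤ c) (hD : (ℓ 0 : ℝ) + 1 ≤ D) {x : EuclideanSpace ℝ (Fin (ℓ 0))}
    (hx : ∀ i, x i ∈ Set.Icc a b) : √(‖x‖ ^ 2 + 1) ≤ √(D * c ^ 2) := by
  refine Real.sqrt_le_sqrt ?_
  have h1 : ‖x‖ ^ 2 ≤ ℓ 0 * c ^ 2 := by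
    rw [EuclideanSpace.norm_sq_eq]
    have h := Finset.sum_le_card_nsmul Finset.univ (fun i => ‖x i‖ ^ 2) (c ^ 2) fun i _ =>
      pow_le_pow_left₀ (norm_nonneg _) (abs_le.2 ⟨(abs_le.1 ha).1.trans (hx i).1,
        (hx i).2.trans (abs_le.1 hb).2⟩) 2
    simpa using h
  have h2 : 1 ≤ c ^ 2 := one_le_pow₀ hc
  nlinarith

/-- Convergence of stochastic gradient descent along trajectories that are almost surely bounded
and along which the Lyapunov function controls the empirical risks. -/
theorem tendsto_risk_of_bounded {Ω : Type*} [MeasurableSpace Ω] {P : Measure Ω}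
    [IsProbabilityMeasure P] {R : ℝ → ℝ → ℝ} (hR : IsReLUApproximation R)
    {ξ : EuclideanSpace ℝ (Fin (ℓ (K + 1)))} {M : ℕ → ℕ} (hM : ∀ n, 1 ≤ M n)
    {X : ℕ → ℕ → Ω → EuclideanSpace ℝ (Fin (ℓ 0))} (hX_meas : ∀ n m, Measurable (X n m))
    (hX_indep : iIndepFun (fun p : ℕ × ℕ => X p.1 p.2) P)
    (hX_ident : ∀ n m, IdentDistrib (X n m) (X 0 0) P P)
    {Θ : ℕ → Ω → Params ℓ (K + 1)} (hΘ_meas : ∀ n, Measurable (Θ n)) {γ : ℕ → ℝ}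
    (hγ : ∀ n, 0 ≤ γ n)
    (hγ_sum : Tendsto (fun N => ∑ k ∈ Finset.range N, γ k) atTop atTop)
    (hΘ_indep : IndepFun (Θ 0) (fun ω (p : ℕ × ℕ) => X p.1 p.2 ω) P)
    (hΘ : ∀ n ω, Θ (n + 1) ω
      = Θ n ω - γ n • riskGradient ξ (M n) (fun m => X n m ω) (Θ n ω))
    {A Y B : ℝ} (hA0 : 0 ≤ A) (hY : ∀ n m ω, √(‖X n m ω‖ ^ 2 + 1) ≤ Y)
    (hA : ∀ᵐ ω ∂P, ∀ n, ‖Θ n ω‖ ^ 2 + 1 ≤ A ^ 2)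
    (hB : ∀ᵐ ω ∂P, ∀ n, ∑ k ∈ Finset.range n,
      γ k * empiricalRisk reluActivation ξ (M k) (fun m => X k m ω) (Θ k ω) ≤ B) :
    (∀ᵐ ω ∂P, Tendsto (fun n => risk P (X 0 0) ξ (Θ n ω)) atTop (𝓝 0)) ∧
    (∀ n, Integrable (fun ω => risk P (X 0 0) ξ (Θ n ω)) P) ∧
      Tendsto (fun n => ∫ ω, risk P (X 0 0) ξ (Θ n ω) ∂P) atTop (𝓝 0) := by
  have hAn : ∀ n, ∀ᵐ ω ∂P, ‖Θ n ω‖ ^ 2 + 1 ≤ A ^ 2 := fun n => hA.mono fun ω h => h n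
  have hint_risk : ∀ n, Integrable (fun ω => risk P (X 0 0) ξ (Θ n ω)) P := fun n =>
    integrable_risk (hΘ_meas n) (hX_meas 0 0) (hAn n) hA0 (hY 0 0) le_rfl
  have hint_sq : ∀ n m, Integrable (fun ω => sqError ξ (Θ n ω) (X n m ω)) P := fun n m =>
    integrable_sqError (hΘ_meas n) (hX_meas n m) (hAn n) hA0 (hY n m) le_rfl
  have hint_emp : ∀ n, Integrable (fun ω =>
      empiricalRisk reluActivation ξ (M n) (fun m => X n m ω) (Θ n ω)) P := fun n =>
    (integrable_finsetSum _ fun m _ => hint_sq n m).const_mul _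
  -- The empirical risk at `Θ n` is unbiased, by independence of the current batch.
  have hemp : ∀ n, ∫ ω, empiricalRisk reluActivation ξ (M n) (fun m => X n m ω) (Θ n ω) ∂P
      = ∫ ω, risk P (X 0 0) ξ (Θ n ω) ∂P := by
    intro n
    simp only [empiricalRisk_eq]
    rw [integral_const_mul, integral_finsetSum _ fun m _ => hint_sq n m]
    have hM0 : (M n : ℝ) ≠ 0 := Nat.cast_ne_zero.2 (Nat.one_le_iff_ne_zero.1 (hM n))
    have h : ∀ m, ∫ ω, sqError ξ (Θ n ω) (X n m ω) ∂P = ∫ ω, risk P (X 0 0) ξ (Θ n ω) ∂P :=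
      fun m => integral_sqError_eq_integral_risk (hΘ_meas n) (hX_meas n m) (hX_meas 0 0)
        (hX_ident n m)
        (indepFun_iterate hR hX_meas hX_indep (hΘ_meas 0) hΘ_indep hΘ n m) (hint_sq n m)
    simp only [h, Finset.sum_const, Nat.card_Icc, Nat.add_sub_cancel, nsmul_eq_mul]
    rw [← mul_assoc, one_div_mul_cancel hM0, one_mul]
  have hsummable : ∀ᵐ ω ∂P, Summable fun n => γ n * risk P (X 0 0) ξ (Θ n ω) := by
    refine ae_summable_of_sum_integral_le (B := B) (fun n => (hint_risk n).const_mul (γ n))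
      (fun n ω => mul_nonneg (hγ n) (risk_nonneg _ _ _)) fun N => ?_
    have h1 : ∑ n ∈ Finset.range N, ∫ ω, γ n * risk P (X 0 0) ξ (Θ n ω) ∂P
        = ∫ ω, ∑ k ∈ Finset.range N,
          γ k * empiricalRisk reluActivation ξ (M k) (fun m => X k m ω) (Θ k ω) ∂P := by
      rw [integral_finsetSum _ fun k _ => (hint_emp k).const_mul (γ k)]
      simp only [integral_const_mul, hemp]
    rw [h1]
    have h2 := integral_mono_ae
      (integrable_finsetSum (Finset.range N) fun k _ => (hint_emp k).const_mul (γ k))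
      (integrable_const B) (hB.mono fun ω h => h N)
    rwa [integral_const, probReal_univ, one_smul] at h2
  have hlim : ∀ᵐ ω ∂P, Tendsto (fun n => risk P (X 0 0) ξ (Θ n ω)) atTop (𝓝 0) := by
    filter_upwards [hsummable, hA] with ω h1 h2
    -- `Λ` is a Lipschitz constant of the risk on the bounded region, and `F` below bounds the
    -- squared gradient norm there, so one step changes the risk by at most `Λ √F γ n`.
    set Λ := ((K + 1) * A ^ K * Y) * (2 * (A ^ (K + 1) * Y + ‖ξ‖)) with hΛ
    have hY0 : 0 ≤ Y := (Real.sqrt_nonneg _).trans (hY 0 0 ω)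
    have hΛ0 : 0 ≤ Λ := by positivity
    set F := 4 * ((K + 1) * A ^ K * Y) ^ 2 * (A ^ (K + 1) * Y + ‖ξ‖) ^ 2 with hF
    refine tendsto_zero_of_summable_mul (C := Λ * √F) (fun n => risk_nonneg _ _ _) hγ hγ_sum h1
      fun n => ?_
    have h3 := risk_sub_le (P := P) (hX_meas 0 0) (h2 n) (h2 (n + 1)) hA0 (hY 0 0) le_rfl (ξ := ξ)
    rw [hΘ n ω] at h3 ⊢
    rw [sub_sub_cancel, norm_smul, Real.norm_eq_abs, abs_of_nonneg (hγ n)] at h3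
    have h4 : ‖riskGradient ξ (M n) (fun m => X n m ω) (Θ n ω)‖ ≤ √F := by
      refine Real.le_sqrt_of_sq_le ((norm_sq_riskGradient_le ξ (hM n) (h2 n) hA0
        fun m => hY n m ω).trans ?_)
      exact mul_le_mul_of_nonneg_left (empiricalRisk_le (hM n) (h2 n) hA0
        (fun m => hY n m ω) le_rfl) (by positivity)
    calc _ ≤ Λ * (γ n * ‖riskGradient ξ (M n) (fun m => X n m ω) (Θ n ω)‖) := h3
      _ ≤ Λ * (γ n * √F) := by gcongr; exact hγ n
      _ = _ := by ring
  refine ⟨hlim, hint_risk, ?_⟩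
  have h := tendsto_integral_of_dominated_convergence (μ := P)
    (F := fun n ω => risk P (X 0 0) ξ (Θ n ω)) (f := fun _ => 0)
    (fun _ => (A ^ (K + 1) * Y + ‖ξ‖) ^ 2) (fun n => (hint_risk n).aestronglyMeasurable)
    (integrable_const _) (fun n => ?_) hlim
  · simpa using h
  · filter_upwards [hAn n] with ω hω
    rw [Real.norm_eq_abs, abs_of_nonneg (risk_nonneg _ _ _)]
    exact risk_le (hX_meas 0 0) hω hA0 (hY 0 0) le_rfl

end DeepReLU

theorem theorem1p1 (L : ℕ) (hL : 1 ≤ L) (ℓ : ℕ → ℕ) (hℓ : ∀ k, 1 ≤ ℓ k)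
    (a b : ℝ) (hab : a < b) (ξ : EuclideanSpace ℝ (Fin (ℓ L)))
    (R : ℝ → ℝ → ℝ) (hR : DeepReLU.IsReLUApproximation R)
    {Ω : Type*} [MeasurableSpace Ω] (P : Measure Ω) [IsProbabilityMeasure P]
    (X : ℕ → ℕ → Ω → EuclideanSpace ℝ (Fin (ℓ 0)))
    (hX_meas : ∀ n m, Measurable (X n m))
    (hX_mem : ∀ n m ω i, X n m ω i ∈ Set.Icc a b)
    (hX_indep : iIndepFun (fun p : ℕ × ℕ => X p.1 p.2) P)
    (hX_ident : ∀ n m, IdentDistrib (X n m) (X 0 0) P P)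
    (M : ℕ → ℕ) (hM : ∀ n, 1 ≤ M n)
    (G : ℕ → DeepReLU.Params ℓ L → Ω → DeepReLU.Params ℓ L)
    (hG : DeepReLU.IsGeneralizedGradient R ξ M X G)
    (Θ : ℕ → Ω → DeepReLU.Params ℓ L) (hΘ_meas : ∀ n, Measurable (Θ n))
    (γ : ℕ → ℝ) (hγ_nonneg : ∀ n, 0 ≤ γ n)
    (hΘ_indep : IndepFun (Θ 0) (fun ω (p : ℕ × ℕ) => X p.1 p.2 ω) P)
    (hΘ_step : ∀ n ω, Θ (n + 1) ω = Θ n ω - γ n • G n (Θ n ω) ω)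
    (hγ_small : ∀ n, ∀ᵐ ω ∂P,
      (4 * (L : ℝ) * (DeepReLU.numParams ℓ L : ℝ) * max (max |a| |b|) (max ‖ξ‖ 1)) ^ (2 * L) * γ n
        ≤ ((‖Θ 0 ω‖ + 1) ^ (2 * L))⁻¹)
    (hγ_sum : Tendsto (fun N => ∑ k ∈ Finset.range N, γ k) atTop atTop) :
    (∃ C : ℝ, ∀ᵐ ω ∂P, ∀ n, ‖Θ n ω‖ ≤ C) ∧
    (∀ᵐ ω ∂P, Tendsto (fun n => DeepReLU.risk P (X 0 0) ξ (Θ n ω)) atTop (𝓝 0)) ∧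
    ((∀ n, Integrable (fun ω => DeepReLU.risk P (X 0 0) ξ (Θ n ω)) P) ∧
      Tendsto (fun n => ∫ ω, DeepReLU.risk P (X 0 0) ξ (Θ n ω) ∂P) atTop (𝓝 0)) := by
  obtain ⟨K, rfl⟩ : ∃ K, L = K + 1 := ⟨L - 1, by omega⟩
  set c := max (max |a| |b|) (max ‖ξ‖ 1) with hc_def
  set D : ℝ := (DeepReLU.numParams ℓ (K + 1) : ℝ) with hD_def
  have ha : |a| ≤ c := (le_max_left _ _).trans (le_max_left _ _)
  have hb : |b| ≤ c := (le_max_right _ _).trans (le_max_left _ _)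
  have hξ : ‖ξ‖ ≤ c := (le_max_left _ _).trans (le_max_right _ _)
  have hc : 1 ≤ c := (le_max_right _ _).trans (le_max_right _ _)
  have hD : (ℓ 0 : ℝ) + 1 ≤ D := by
    rw [hD_def]
    exact_mod_cast DeepReLU.succ_le_numParams (K := K) hℓ
  have hD1 : 1 ≤ D := by linarith [(ℓ 0).cast_nonneg (α := ℝ)]
  have hY : ∀ n m ω, √(‖X n m ω‖ ^ 2 + 1) ≤ √(D * c ^ 2) := fun n m ω =>
    DeepReLU.sqrt_norm_sq_add_one_le_of_mem_Icc ha hb hc hD (hX_mem n m ω)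
  have hΘ : ∀ n ω, Θ (n + 1) ω
      = Θ n ω - γ n • DeepReLU.riskGradient ξ (M n) (fun m => X n m ω) (Θ n ω) := fun n ω => by
    rw [hΘ_step, hG.eq_riskGradient hR]
  push_cast at hγ_small
  have hsmall := ae_all_iff.2 hγ_small
  -- One positive step size turns the smallness condition into the deterministic bound `T` on `‖Θ 0‖
  -- + 1`.
  obtain ⟨n₀, hn₀⟩ : ∃ n, 0 < γ n := by
    by_contra! h
    have h0 : ∀ n, γ n = 0 := fun n => le_antisymm (h n) (hγ_nonneg n)
    simp only [h0, Finset.sum_const_zero] at hγ_sum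
    exact not_tendsto_const_atTop _ _ hγ_sum
  set T : ℝ := ((4 * (K + 1) * D * c) ^ (2 * (K + 1)) * γ n₀)⁻¹ with hT_def
  have hT : ∀ᵐ ω ∂P, ‖Θ 0 ω‖ + 1 ≤ T := by
    filter_upwards [hsmall] with ω hω
    have h1 : 1 ≤ ‖Θ 0 ω‖ + 1 := by linarith [norm_nonneg (Θ 0 ω)]
    have h2 : (‖Θ 0 ω‖ + 1) ^ (2 * (K + 1)) ≤ T :=
      (le_inv_comm₀ (by positivity) (by positivity)).1 (hω n₀)
    exact (le_self_pow₀ h1 (by omega)).trans h2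
  have hT0 : 0 ≤ T := by positivity
  have htraj : ∀ᵐ ω ∂P, ∀ n, DeepReLU.lyapunov ξ (Θ n ω) + 3 * (K + 1) * ∑ k ∈ Finset.range n,
      γ k * DeepReLU.empiricalRisk DeepReLU.reluActivation ξ (M k) (fun m => X k m ω) (Θ k ω)
        ≤ DeepReLU.lyapunov ξ (Θ 0 ω) := by
    filter_upwards [hsmall] with ω hω
    exact DeepReLU.trajectory_lyapunov_le hM hξ hc hD1 (fun n m => hY n m ω) hγ_nonneg hω
      (θ := fun n => Θ n ω) (fun n => hΘ n ω)
  have hsum0 : ∀ ω n, 0 ≤ ∑ k ∈ Finset.range n,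
      γ k * DeepReLU.empiricalRisk DeepReLU.reluActivation ξ (M k) (fun m => X k m ω) (Θ k ω) :=
    fun ω n => Finset.sum_nonneg fun k _ =>
      mul_nonneg (hγ_nonneg k) (DeepReLU.empiricalRisk_nonneg _ _ _ _)
  -- The radius of the trajectory estimate with `T` in place of `‖Θ 0 ω‖ + 1`, hence independent of
  -- `ω`.
  have hA2 : (√(5 * (K + 1) * (c * T) ^ 2)) ^ 2 = 5 * (K + 1) * (c * T) ^ 2 :=
    Real.sq_sqrt (by positivity)
  have hA : ∀ᵐ ω ∂P, ∀ n, ‖Θ n ω‖ ^ 2 + 1 ≤ (√(5 * (K + 1) * (c * T) ^ 2)) ^ 2 := by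
    filter_upwards [htraj, hT] with ω h1 h2 n
    have h3 : DeepReLU.lyapunov ξ (Θ n ω) ≤ DeepReLU.lyapunov ξ (Θ 0 ω) := by
      have h4 : 0 ≤ 3 * ((K : ℝ) + 1) * ∑ k ∈ Finset.range n, γ k *
          DeepReLU.empiricalRisk DeepReLU.reluActivation ξ (M k) (fun m => X k m ω) (Θ k ω) :=
        mul_nonneg (by positivity) (hsum0 ω n)
      linarith [h1 n]
    rw [hA2]
    refine (DeepReLU.norm_sq_add_one_le_of_lyapunov_le ξ hξ hc h3).trans ?_
    gcongr
  have hB : ∀ᵐ ω ∂P, ∀ n, ∑ k ∈ Finset.range n,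
      γ k * DeepReLU.empiricalRisk DeepReLU.reluActivation ξ (M k) (fun m => X k m ω) (Θ k ω)
        ≤ (K + 1) * (T + c) ^ 2 := by
    filter_upwards [htraj, hT] with ω h1 h2 n
    have h3 := DeepReLU.lyapunov_le ξ (Θ 0 ω) hξ
    have h4 := DeepReLU.lyapunov_nonneg ξ (Θ n ω)
    have h5 : ((K : ℝ) + 1) * (‖Θ 0 ω‖ + c) ^ 2 ≤ (K + 1) * (T + c) ^ 2 := by
      gcongr
      linarith
    have h6 := le_mul_of_one_le_left (hsum0 ω n)
      (by linarith [K.cast_nonneg (α := ℝ)] : 1 ≤ 3 * ((K : ℝ) + 1))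
    linarith [h1 n]
  refine ⟨⟨√(5 * (K + 1) * (c * T) ^ 2), ?_⟩, ?_⟩
  · filter_upwards [hA] with ω h n
    exact (abs_le_of_sq_le_sq' (by linarith [h n]) (Real.sqrt_nonneg _)).2
  · exact DeepReLU.tendsto_risk_of_bounded hR hM hX_meas hX_indep hX_ident hΘ_meas hγ_nonneg
      hγ_sum hΘ_indep hΘ (Real.sqrt_nonneg _) hY hA hB
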